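/- Let $\rho_0,\rho_1$ be probability measures on $\mathbb{R}^d$ that are absolutely continuous with respect to Lebesgue measure, and let $c:\mathbb{R}^d\times\mathbb{R}^d\to[0,\infty)$ be continuous with $c(x,y)=0$ if and only if $x=y$. Suppose that for some $p\ge 1$ and some constants $A,B>0$ one has $c(x,y)\le A+B(|x|^p+|y|^p)$ whenever $|x|$ and $|y|$ are both sufficiently large, and that $\rho_0,\rho_1$ have finite $p$-th moments. Let $\varepsilon>0$ and let $\mu_\varepsilon$ be the static Schrödinger bridge from $\rho_0$ to $\rho_1$ at temperature $\varepsilon$ with Schrödinger potentials $a_\varepsilon,b_\varepsilon$; that is, $a_\varepsilon,b_\varepsilon:\mathbb{R}^d\to\mathbb{R}$ are measurable and $$\mu_\varepsilon(dx\,dy)=\xi(x,y)\,\rho_0(dx)\,\rho_1(dy),\qquad \xi(x,y)=\exp\Big(-\tfrac1\varepsilon\big(c(x,y)-a_\varepsilon(x)-b_\varepsilon(y)\big)\Big),$$ is a probability measure with marginals $\rho_0$ and $\rho_1$. Assume that $a_\varepsilon\in L^1(\rho_0)$, $b_\varepsilon\in L^1(\rho_1)$ and $\xi\in L^2(\rho_0\otimes\rho_1)$.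 Let $\mathcal{A}:L^2(\rho_0)\to L^2(\rho_1)$ be the operator $(\mathcal{A}f)(y)=\int f(x)\,\xi(x,y)\,\rho_0(dx)$, with adjoint $\mathcal{A}^*$. Assume that $\mathcal{A}$ is compact and that $\mathcal{A}^*\mathcal{A}$ and $\mathcal{A}\mathcal{A}^*$ have a positive eigenvalue gap: there is $r<1$ such that every eigenvalue of $\mathcal{A}^*\mathcal{A}$ (respectively $\mathcal{A}\mathcal{A}^*$) with an eigenfunction orthogonal to the constant function $\mathbf 1$ in $L^2(\rho_0)$ (respectively $L^2(\rho_1)$) is at most $r$. On the space $(\mathbb{R}^d\times\mathbb{R}^d)^{\mathbb N}$ of sequences $(X_i,Y_i)_{i\ge1}$, let $P^\infty$ be the law under which the pairs $(X_i,Y_i)$ are i.i.d. with law $\rho_0\otimes\rho_1$, and $Q^\infty$ the law under which they are i.i.d. with law $\mu_\varepsilon$. Let $\widehat\rho_0^N=\frac1N\sum_{i=1}^N\delta_{X_i}$ and $\widehat\rho_1^N=\frac1N\sum_{i=1}^N\delta_{Y_i}$, let $\mathcal{G}_N$ be the $\sigma$-algebra generated by $(\widehat\rho_0^N,\widehat\rho_1^N)$,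 and let $R^N$ and $S^N$ be the laws of $(\widehat\rho_0^N,\widehat\rho_1^N)$ under $P^\infty$ and $Q^\infty$, respectively. Then $(R^N)_{N\ge1}$ is contiguous with respect to $(S^N)_{N\ge1}$: for all measurable sets $B_N$ of pairs of measures, $S^N(B_N)\to0$ implies $R^N(B_N)\to0$. Explicitly, for every sequence of events $A_N\in\mathcal{G}_N$ with $\lim_{N\to\infty}Q^\infty(A_N)=0$ one has $\lim_{N\to\infty}P^\infty(A_N)=0$. -/

import Mathlib

open MeasureTheory Filter Topology
open scoped ENNReal

noncomputable section

section KernelOperators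

variable {α β : Type*} [MeasurableSpace α] [MeasurableSpace β]
  {μ : Measure α} {ν : Measure β} [IsProbabilityMeasure μ] [IsProbabilityMeasure ν]

/-- The function `y ↦ ∫ f(x) k(x, y) μ(dx)`. -/
def kernelIntegral (μ : Measure α) (k : α × β → ℝ) (f : α → ℝ) (y : β) : ℝ :=
  ∫ x, f x * k (x, y) ∂μ

theorem eLpNorm_kernelIntegral_le {k : α × β → ℝ} (hk : MemLp k 2 (μ.prod ν)) {f : α → ℝ}
    (hf : MemLp f 2 μ) :
    eLpNorm (kernelIntegral μ k f) 2 ν ≤ eLpNorm k 2 (μ.prod ν) * eLpNorm f 2 μ := by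
  have hk' : AEStronglyMeasurable (fun z : β × α => k z.swap) (ν.prod μ) := hk.1.prod_swap
  have key : ∀ᵐ y ∂ν, ‖kernelIntegral μ k f y‖ₑ ^ (2 : ℝ) ≤
      (∫⁻ x, ‖f x‖ₑ ^ (2 : ℝ) ∂μ) * ∫⁻ x, ‖k (x, y)‖ₑ ^ (2 : ℝ) ∂μ := by
    filter_upwards [hk'.prodMk_left] with y hy
    have h1 : ‖kernelIntegral μ k f y‖ₑ ≤ ∫⁻ x, ‖f x‖ₑ * ‖k (x, y)‖ₑ ∂μ := by
      refine (enorm_integral_le_lintegral_enorm _).trans (le_of_eq ?_)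
      simp only [enorm_mul]
    have h2 := ENNReal.lintegral_mul_le_Lp_mul_Lq μ Real.HolderConjugate.two_two
      hf.1.enorm hy.enorm
    have h3 := h1.trans h2
    calc ‖kernelIntegral μ k f y‖ₑ ^ (2 : ℝ)
        ≤ _ := ENNReal.rpow_le_rpow h3 (by norm_num)
      _ = _ := by
        rw [ENNReal.mul_rpow_of_nonneg _ _ (by norm_num), ← ENNReal.rpow_mul,
          ← ENNReal.rpow_mul]
        norm_num
  have hint : ∫⁻ y, ∫⁻ x, ‖k (x, y)‖ₑ ^ (2 : ℝ) ∂μ ∂ν = ∫⁻ z, ‖k z‖ₑ ^ (2 : ℝ) ∂(μ.prod ν) :=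
    (lintegral_prod_symm _ (hk.1.enorm.pow_const _)).symm
  have hf2 : ∫⁻ x, ‖f x‖ₑ ^ (2 : ℝ) ∂μ ≠ ∞ := by
    have := lintegral_rpow_enorm_lt_top_of_eLpNorm_lt_top (p := 2) (by norm_num) (by norm_num) hf.2
    simpa using this.ne
  rw [eLpNorm_eq_lintegral_rpow_enorm_toReal (by norm_num) (by norm_num),
    eLpNorm_eq_lintegral_rpow_enorm_toReal (by norm_num) (by norm_num),
    eLpNorm_eq_lintegral_rpow_enorm_toReal (by norm_num) (by norm_num)]
  simp only [ENNReal.toReal_ofNat]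
  rw [← ENNReal.mul_rpow_of_nonneg _ _ (by norm_num)]
  refine ENNReal.rpow_le_rpow ?_ (by norm_num)
  refine (lintegral_mono_ae key).trans ?_
  rw [lintegral_const_mul' _ _ hf2, hint, mul_comm]

theorem memLp_kernelIntegral {k : α × β → ℝ} (hk : MemLp k 2 (μ.prod ν)) {f : α → ℝ}
    (hf : MemLp f 2 μ) : MemLp (kernelIntegral μ k f) 2 ν := by
  refine ⟨?_, (eLpNorm_kernelIntegral_le hk hf).trans_lt (ENNReal.mul_lt_top hk.2 hf.2)⟩
  have h : AEStronglyMeasurable (fun z : β × α => f z.2 * k z.swap) (ν.prod μ) :=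
    hf.1.comp_snd.mul hk.1.prod_swap
  exact h.integral_prod_right'

theorem ae_integrable_kernel {k : α × β → ℝ} (hk : MemLp k 2 (μ.prod ν)) {f : α → ℝ}
    (hf : MemLp f 2 μ) : ∀ᵐ y ∂ν, Integrable (fun x => f x * k (x, y)) μ := by
  have h2 : MemLp (fun z : β × α => k z.swap) 2 (ν.prod μ) :=
    hk.comp_measurePreserving Measure.measurePreserving_swap
  have h1 : MemLp (fun z : β × α => f z.2) 2 (ν.prod μ) :=
    hf.comp_measurePreserving measurePreserving_snd
  exact (h1.integrable_mul h2).prod_right_ae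

/-- The bounded operator `L²(μ) → L²(ν)`, `f ↦ (y ↦ ∫ f(x) k(x, y) μ(dx))`,
with square integrable kernel `k`. -/
def kernelOperator (k : α × β → ℝ) (hk : MemLp k 2 (μ.prod ν)) :
    Lp ℝ 2 μ →L[ℝ] Lp ℝ 2 ν :=
  LinearMap.mkContinuous
    { toFun := fun f => (memLp_kernelIntegral hk (Lp.memLp f)).toLp (kernelIntegral μ k f)
      map_add' := by
        intro f g
        rw [← MemLp.toLp_add]
        refine MemLp.toLp_congr _ _ ?_
        filter_upwards [ae_integrable_kernel hk (Lp.memLp f),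
          ae_integrable_kernel hk (Lp.memLp g)] with y hf hg
        simp only [kernelIntegral, Pi.add_apply]
        rw [← integral_add hf hg]
        refine integral_congr_ae ?_
        filter_upwards [Lp.coeFn_add f g] with x hx
        rw [hx, Pi.add_apply, add_mul]
      map_smul' := by
        intro r f
        rw [RingHom.id_apply, ← MemLp.toLp_const_smul]
        refine MemLp.toLp_congr _ _ (Eventually.of_forall fun y => ?_)
        simp only [kernelIntegral, Pi.smul_apply, smul_eq_mul]
        rw [← integral_const_mul]
        refine integral_congr_ae ?_
        filter_upwards [Lp.coeFn_smul r f] with x hx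
        rw [hx, Pi.smul_apply, smul_eq_mul, mul_assoc] }
    (eLpNorm k 2 (μ.prod ν)).toReal
    (by
      intro f
      change ‖(memLp_kernelIntegral hk (Lp.memLp f)).toLp (kernelIntegral μ k f)‖ ≤ _
      rw [Lp.norm_toLp, Lp.norm_def, ← ENNReal.toReal_mul]
      exact ENNReal.toReal_mono (ENNReal.mul_lt_top hk.2 (Lp.memLp f).2).ne
        (eLpNorm_kernelIntegral_le hk (Lp.memLp f)))

theorem kernelOperator_ae_eq (k : α × β → ℝ) (hk : MemLp k 2 (μ.prod ν)) (f : Lp ℝ 2 μ) :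
    kernelOperator k hk f =ᵐ[ν] fun y => ∫ x, f x * k (x, y) ∂μ :=
  MemLp.coeFn_toLp (memLp_kernelIntegral hk (Lp.memLp f))

/-- The operator `T` has an eigenvalue gap below the eigenvalue of the vector `e`: for some
`r < 1`, every eigenvalue of `T` that has an eigenvector orthogonal to `e` is at most `r`. -/
def HasEigenvalueGap {H : Type*} [NormedAddCommGroup H] [InnerProductSpace ℝ H]
    (T : H →L[ℝ] H) (e : H) : Prop :=
  ∃ r : ℝ, r < 1 ∧ ∀ (t : ℝ) (f : H), f ≠ 0 → inner ℝ e f = 0 → T f = t • f → t ≤ r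

end KernelOperators

section Bridge

variable {E : Type*} [MeasurableSpace E]

/-- `ξ(x, y) = exp (-(c(x, y) - a(x) - b(y)) / ε)`. -/
def bridgeDensity (c : E → E → ℝ) (ε : ℝ) (a b : E → ℝ) (z : E × E) : ℝ :=
  Real.exp (-(1 / ε) * (c z.1 z.2 - a z.1 - b z.2))

/-- `μ` is the static Schrödinger bridge from `ρ₀` to `ρ₁` at temperature `ε` for the cost `c`,
with Schrödinger potentials `a`, `b`: it is a coupling of `ρ₀` and `ρ₁`, of the form
`μ(dx dy) = ξ(x, y) ρ₀(dx) ρ₁(dy)`. -/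
structure IsSchrodingerBridge (c : E → E → ℝ) (ε : ℝ) (ρ₀ ρ₁ : Measure E) (a b : E → ℝ)
    (μ : Measure (E × E)) : Prop where
  measurable_left : Measurable a
  measurable_right : Measurable b
  eq_withDensity :
    μ = (ρ₀.prod ρ₁).withDensity fun z => ENNReal.ofReal (bridgeDensity c ε a b z)
  fst_eq : μ.fst = ρ₀
  snd_eq : μ.snd = ρ₁

end Bridge

section Empirical

variable {E : Type*} [MeasurableSpace E]

/-- The pair `(N⁻¹ ∑_{i < N} δ_{X_i}, N⁻¹ ∑_{i < N} δ_{Y_i})` of marginal empirical distributions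
of the first `N` terms of a sequence of pairs `ω i = (X_i, Y_i)`. -/
def empiricalPair (N : ℕ) (ω : ℕ → E × E) : Measure E × Measure E :=
  ((N : ℝ≥0∞)⁻¹ • ∑ i ∈ Finset.range N, Measure.dirac (ω i).1,
    (N : ℝ≥0∞)⁻¹ • ∑ i ∈ Finset.range N, Measure.dirac (ω i).2)

theorem measurable_empiricalPair (N : ℕ) :
    Measurable (empiricalPair N : (ℕ → E × E) → Measure E × Measure E) := by
  refine Measurable.prodMk ?_ ?_ <;>
  · refine Measure.measurable_of_measurable_coe _ fun s hs => ?_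
    simp only [Measure.smul_apply, Measure.coe_finsetSum, Finset.sum_apply, smul_eq_mul,
      Measure.dirac_apply' _ hs]
    refine Measurable.const_mul (Finset.measurable_sum _ fun i _ => ?_) _
    exact (measurable_one.indicator hs).comp (by fun_prop)

/-- The σ-algebra on the sequence space generated by the pair of marginal empirical
distributions of the first `N` terms. -/
@[reducible] def empiricalSigma (E : Type*) [MeasurableSpace E] (N : ℕ) : MeasurableSpace (ℕ → E × E) :=
  MeasurableSpace.comap (empiricalPair N) inferInstance

/-- The law of an infinite i.i.d. sequence with common law `π`. -/
def iidLaw (π : Measure (E × E)) : Measure (ℕ → E × E) :=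
  Measure.infinitePi fun _ : ℕ => π

/-- The law of the pair of marginal empirical distributions of `N` i.i.d. pairs of law `π`. -/
def empiricalPairLaw (π : Measure (E × E)) (N : ℕ) : Measure (Measure E × Measure E) :=
  (iidLaw π).map (empiricalPair N)

/-- The sequence of measures `R` is contiguous with respect to the sequence `S`. -/
def IsContiguous {Ω : ℕ → Type*} [∀ N, MeasurableSpace (Ω N)] (R S : ∀ N, Measure (Ω N)) : Prop :=
  ∀ A : ∀ N, Set (Ω N), (∀ N, MeasurableSet (A N)) →
    Tendsto (fun N => S N (A N)) atTop (𝓝 0) → Tendsto (fun N => R N (A N)) atTop (𝓝 0)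

end Empirical

end

/-!
On events invariant under permuting the `y_i`, the law of an `N`-sample of the bridge has, with
respect to two independent samples of the marginals, the density
`L_N(x, y) = (1 / N!) ∑_σ ∏_i ξ(x_i, y_{σ i})`, so contiguity follows once `L_N` is bounded away
from `0` with probability close to `1`, uniformly for large `N`.

The singular value decomposition of the kernel operator reads `ξ = 1 + ∑_i s_i φ_i ⊗ ψ_i`, with
`s_i² ≤ r < 1` by the eigenvalue gap and `∑ s_i² < ∞`. Expanding over permutations bounds `E L_N²`
by `C = sup_K ∏_{i ∈ K} (1 - s_i²)⁻¹`, over finite sets `K` of indices. By the central limit theorem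
the normalized sums of `(φ_i, ψ_i)_{i ∈ K}` converge to independent standard Gaussians under
independent sampling, and to Gaussians with correlations `s_i` under the bridge. The likelihood
ratio of these limits is a product `F_K` of Mehler kernels, and `E F_K² = ∏_{i ∈ K} (1 - s_i²)⁻¹`.
For `H = min(F_K, M)`, evaluated at the normalized sums, the limit of `E (H - L_N)²` is thus at most
`C - E min(F_K, M)²`, which is small for suitable `K` and `M`: the second moment bound `C`
is sharp, and `L_N` is close to `H` in mean square. Finally `F_K` is rarely small,
uniformly in `K`, because `E (-log F_K) ≤ ∑ s_i² / (1 - s_i²)`.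
-/

section ProductMeasures

variable {ι : Type*} [Fintype ι] {X : ι → Type*} [∀ i, MeasurableSpace (X i)]

theorem lintegral_pi_prod (μ : ∀ i, Measure (X i)) [∀ i, IsProbabilityMeasure (μ i)]
    {f : ∀ i, X i → ℝ≥0∞} (hf : ∀ i, Measurable (f i)) :
    ∫⁻ x, ∏ i, f i (x i) ∂Measure.pi μ = ∏ i, ∫⁻ x, f i x ∂μ i := by
  have hindep := ProbabilityTheory.iIndepFun_pi (μ := μ) (X := f) fun i => (hf i).aemeasurable
  rw [ProbabilityTheory.lintegral_prod_eq_prod_lintegral_of_indepFun Finset.univ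
    (fun i (x : ∀ i, X i) => f i (x i)) hindep fun i => by fun_prop]
  exact Finset.prod_congr rfl fun i _ => (measurePreserving_eval μ i).lintegral_comp (hf i)

theorem pi_withDensity (μ : ∀ i, Measure (X i)) [∀ i, IsProbabilityMeasure (μ i)]
    {f : ∀ i, X i → ℝ≥0∞} (hf : ∀ i, Measurable (f i))
    [∀ i, SigmaFinite ((μ i).withDensity (f i))] :
    Measure.pi (fun i => (μ i).withDensity (f i)) =
      (Measure.pi μ).withDensity fun x => ∏ i, f i (x i) := by
  classical
  refine Measure.pi_eq fun s hs => ?_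
  have hindicator (x : ∀ i, X i) : (Set.univ.pi s).indicator (fun x => ∏ i, f i (x i)) x =
      ∏ i, (s i).indicator (f i) (x i) := by
    simp only [Set.indicator_apply, Finset.prod_ite_zero, Set.mem_univ_pi, Finset.mem_univ,
      true_imp_iff]
  rw [withDensity_apply _ (MeasurableSet.univ_pi hs),
    ← lintegral_indicator (MeasurableSet.univ_pi hs), lintegral_congr hindicator,
    lintegral_pi_prod μ fun i => (hf i).indicator (hs i)]
  exact Finset.prod_congr rfl fun i _ => by
    rw [lintegral_indicator (hs i), withDensity_apply _ (hs i)]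

theorem measurePreserving_comp_perm {α : Type*} [MeasurableSpace α] (μ : Measure α)
    [IsProbabilityMeasure μ] (σ : Equiv.Perm ι) :
    MeasurePreserving (fun x : ι → α => x ∘ σ) (Measure.pi fun _ => μ) (Measure.pi fun _ => μ) :=
  (measurePreserving_piCongrLeft (fun _ : ι => μ) σ).symm

end ProductMeasures

section Samples

variable {α β : Type*} [MeasurableSpace α] [MeasurableSpace β]

/-- The joint law of the samples `(X_1, …, X_N)` and `(Y_1, …, Y_N)` when the pairs `(X_i, Y_i)`
are i.i.d. of law `π`. -/
noncomputable def sampleLaw (π : Measure (α × β)) (N : ℕ) :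
    Measure ((Fin N → α) × (Fin N → β)) :=
  (Measure.pi fun _ => π).map (MeasurableEquiv.arrowProdEquivProdArrow α β (Fin N))

instance (π : Measure (α × β)) [IsProbabilityMeasure π] (N : ℕ) :
    IsProbabilityMeasure (sampleLaw π N) :=
  Measure.isProbabilityMeasure_map (MeasurableEquiv.measurable _).aemeasurable

variable (μ : Measure α) (ν : Measure β)

/-- The joint law of two independent i.i.d. samples of size `N`, of laws `μ` and `ν`. -/
noncomputable abbrev indepSampleLaw (N : ℕ) : Measure ((Fin N → α) × (Fin N → β)) :=
  (Measure.pi fun _ => μ).prod (Measure.pi fun _ => ν)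

variable [IsProbabilityMeasure μ] [IsProbabilityMeasure ν]

theorem sampleLaw_prod (N : ℕ) : sampleLaw (μ.prod ν) N = indepSampleLaw μ ν N :=
  (measurePreserving_arrowProdEquivProdArrow α β (Fin N) (fun _ => μ) (fun _ => ν)).map_eq

theorem sampleLaw_withDensity {f : α × β → ℝ≥0∞} (hf : Measurable f)
    [IsProbabilityMeasure ((μ.prod ν).withDensity f)] (N : ℕ) :
    sampleLaw ((μ.prod ν).withDensity f) N =
      (indepSampleLaw μ ν N).withDensity fun z => ∏ i, f (z.1 i, z.2 i) := by
  have hsplit := MeasurableEquiv.measurable (MeasurableEquiv.arrowProdEquivProdArrow α β (Fin N))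
  rw [sampleLaw, pi_withDensity (fun _ : Fin N => μ.prod ν) fun _ => hf, ← sampleLaw_prod,
    sampleLaw]
  ext s hs
  rw [Measure.map_apply hsplit hs, withDensity_apply _ (hsplit hs), withDensity_apply _ hs,
    setLIntegral_map hs (by fun_prop) hsplit]
  rfl

theorem measurePreserving_indepSampleLaw_comp_perm (N : ℕ) (σ : Equiv.Perm (Fin N)) :
    MeasurePreserving (fun z : (Fin N → α) × (Fin N → β) => (z.1, z.2 ∘ σ))
      (indepSampleLaw μ ν N) (indepSampleLaw μ ν N) :=
  (MeasurePreserving.id _).prod (measurePreserving_comp_perm ν σ)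

end Samples

section PairingAverage

variable {α β : Type*}

/-- The average over the pairings of two samples of the product of the values of `k`. When `k` is
the density of a coupling with respect to the product of its marginals, this is the likelihood
ratio of the unordered samples, see `integral_sampleLaw_of_symmetric`. -/
noncomputable def pairingAverage (k : α × β → ℝ) (N : ℕ) (z : (Fin N → α) × (Fin N → β)) : ℝ :=
  (N.factorial : ℝ)⁻¹ * ∑ σ : Equiv.Perm (Fin N), ∏ i, k (z.1 i, z.2 (σ i))

theorem pairingAverage_nonneg {k : α × β → ℝ} (hk : ∀ z, 0 ≤ k z) (N : ℕ)
    (z : (Fin N → α) × (Fin N → β)) : 0 ≤ pairingAverage k N z :=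
  mul_nonneg (by positivity)
    (Finset.sum_nonneg fun _ _ => Finset.prod_nonneg fun _ _ => hk _)

variable [MeasurableSpace α] [MeasurableSpace β]

theorem measurable_pairingAverage {k : α × β → ℝ} (hk : Measurable k) (N : ℕ) :
    Measurable (pairingAverage k N) := by
  unfold pairingAverage
  fun_prop

variable (μ : Measure α) (ν : Measure β) [IsProbabilityMeasure μ] [IsProbabilityMeasure ν]
  {k : α × β → ℝ}

theorem lintegral_symmetric_mul_prod_perm (hk : Measurable k) {N : ℕ}
    {G : (Fin N → α) × (Fin N → β) → ℝ≥0∞} (hG : Measurable G)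
    (hsymm : ∀ x y (σ : Equiv.Perm (Fin N)), G (x, y ∘ σ) = G (x, y)) (σ : Equiv.Perm (Fin N)) :
    ∫⁻ z, G z * ∏ i, ENNReal.ofReal (k (z.1 i, z.2 (σ i))) ∂indepSampleLaw μ ν N =
      ∫⁻ z, G z * ∏ i, ENNReal.ofReal (k (z.1 i, z.2 i)) ∂indepSampleLaw μ ν N := by
  rw [← (measurePreserving_indepSampleLaw_comp_perm μ ν N σ).lintegral_comp
    (f := fun z => G z * ∏ i, ENNReal.ofReal (k (z.1 i, z.2 i))) (by fun_prop)]
  simp only [hsymm, Function.comp_apply]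

theorem lintegral_symmetric_mul_pairingAverage (hk : Measurable k) (hk0 : ∀ z, 0 ≤ k z) {N : ℕ}
    {G : (Fin N → α) × (Fin N → β) → ℝ≥0∞} (hG : Measurable G)
    (hsymm : ∀ x y (σ : Equiv.Perm (Fin N)), G (x, y ∘ σ) = G (x, y)) :
    ∫⁻ z, G z * ENNReal.ofReal (pairingAverage k N z) ∂indepSampleLaw μ ν N =
      ∫⁻ z, G z * ∏ i, ENNReal.ofReal (k (z.1 i, z.2 i)) ∂indepSampleLaw μ ν N := by
  have hexpand (z : (Fin N → α) × (Fin N → β)) : G z * ENNReal.ofReal (pairingAverage k N z) =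
      ENNReal.ofReal (N.factorial : ℝ)⁻¹ *
        ∑ σ : Equiv.Perm (Fin N), G z * ∏ i, ENNReal.ofReal (k (z.1 i, z.2 (σ i))) := by
    simp_rw [pairingAverage, ENNReal.ofReal_mul (inv_nonneg.2 (Nat.cast_nonneg N.factorial)),
      ENNReal.ofReal_sum_of_nonneg fun _ _ => Finset.prod_nonneg fun _ _ => hk0 _,
      ENNReal.ofReal_prod_of_nonneg fun _ _ => hk0 _, ← Finset.mul_sum]
    ring
  simp_rw [hexpand]
  rw [lintegral_const_mul _ (by fun_prop), lintegral_finsetSum _ fun _ _ => by fun_prop]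
  simp_rw [lintegral_symmetric_mul_prod_perm μ ν hk hG hsymm]
  rw [Finset.sum_const, Finset.card_univ, Fintype.card_perm, Fintype.card_fin, nsmul_eq_mul,
    ← mul_assoc, ← ENNReal.ofReal_natCast, ← ENNReal.ofReal_mul (by positivity),
    inv_mul_cancel₀ (by positivity), ENNReal.ofReal_one, one_mul]

theorem integral_sampleLaw_of_symmetric {π : Measure (α × β)} [IsProbabilityMeasure π]
    (hπ : π = (μ.prod ν).withDensity fun z => ENNReal.ofReal (k z)) (hk : Measurable k)
    (hk0 : ∀ z, 0 ≤ k z) {N : ℕ} {G : (Fin N → α) × (Fin N → β) → ℝ} (hG : Measurable G)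
    (hG0 : ∀ z, 0 ≤ G z) (hsymm : ∀ x y (σ : Equiv.Perm (Fin N)), G (x, y ∘ σ) = G (x, y)) :
    ∫ z, G z ∂sampleLaw π N = ∫ z, G z * pairingAverage k N z ∂indepSampleLaw μ ν N := by
  subst hπ
  rw [sampleLaw_withDensity μ ν hk.ennreal_ofReal,
    integral_eq_lintegral_of_nonneg_ae (.of_forall hG0) hG.aestronglyMeasurable,
    integral_eq_lintegral_of_nonneg_ae
      (.of_forall fun z => mul_nonneg (hG0 z) (pairingAverage_nonneg hk0 N z))
      (hG.mul (measurable_pairingAverage hk N)).aestronglyMeasurable,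
    lintegral_withDensity_eq_lintegral_mul _ (by fun_prop) hG.ennreal_ofReal]
  simp_rw [ENNReal.ofReal_mul (hG0 _), Pi.mul_apply]
  rw [lintegral_symmetric_mul_pairingAverage μ ν hk hk0 hG.ennreal_ofReal
    fun x y σ => by rw [hsymm]]
  simp_rw [mul_comm]

end PairingAverage

section PermutationCount

variable {J : Type*} [DecidableEq J] {N : ℕ}

/-- The number of permutations `σ` with `f ∘ σ = g`. -/
def permCount (f g : Fin N → J) : ℕ :=
  (Finset.univ.filter fun σ : Equiv.Perm (Fin N) => f ∘ σ = g).card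

theorem permCount_comp_left (f g : Fin N → J) (τ : Equiv.Perm (Fin N)) :
    permCount (f ∘ τ) g = permCount f g := by
  refine Finset.card_equiv (Equiv.mulLeft τ) fun σ => ?_
  simp only [Finset.mem_filter, Finset.mem_univ, true_and, Equiv.coe_mulLeft, Equiv.Perm.coe_mul]
  rfl

theorem permCount_comp_right (f g : Fin N → J) (τ : Equiv.Perm (Fin N)) :
    permCount f (g ∘ τ) = permCount f g := by
  symm
  refine Finset.card_equiv (Equiv.mulRight τ) fun σ => ?_
  simp only [Finset.mem_filter, Finset.mem_univ, true_and, Equiv.coe_mulRight, Equiv.Perm.coe_mul,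
    ← Function.comp_assoc]
  exact (τ.surjective.injective_comp_right.eq_iff).symm

theorem exists_perm_of_permCount_ne_zero {f g : Fin N → J} (h : permCount f g ≠ 0) :
    ∃ τ : Equiv.Perm (Fin N), g = f ∘ τ := by
  obtain ⟨τ, hτ⟩ := Finset.card_ne_zero.1 h
  exact ⟨τ, (Finset.mem_filter.1 hτ).2.symm⟩

theorem sum_perm_comp_eq_sum_permCount [Fintype J] {M : Type*} [AddCommMonoid M] (f : Fin N → J)
    (u : (Fin N → J) → M) :
    ∑ σ : Equiv.Perm (Fin N), u (f ∘ σ) = ∑ g, permCount f g • u g := by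
  rw [← Finset.sum_fiberwise_of_maps_to (t := Finset.univ)
    (g := fun σ : Equiv.Perm (Fin N) => f ∘ σ) fun _ _ => Finset.mem_univ _]
  refine Finset.sum_congr rfl fun g _ => ?_
  rw [Finset.sum_congr rfl fun σ hσ => by rw [(Finset.mem_filter.1 hσ).2], Finset.sum_const,
    permCount]

theorem sum_permCount [Fintype J] (f : Fin N → J) : ∑ g, permCount f g = N.factorial := by
  have h := sum_perm_comp_eq_sum_permCount f fun _ => (1 : ℕ)
  simpa [Fintype.card_perm] using h.symm

theorem sum_permCount_sq [Fintype J] (f : Fin N → J) :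
    ∑ g, permCount f g ^ 2 = N.factorial * permCount f f := by
  rw [← sum_permCount f, Finset.sum_mul]
  refine Finset.sum_congr rfl fun g _ => ?_
  by_cases h : permCount f g = 0
  · simp [h]
  · obtain ⟨τ, rfl⟩ := exists_perm_of_permCount_ne_zero h
    rw [sq, permCount_comp_right]

theorem exists_perm_of_card_fiber_eq {f g : Fin N → J}
    (h : ∀ j, (Finset.univ.filter fun i => f i = j).card =
      (Finset.univ.filter fun i => g i = j).card) :
    ∃ τ : Equiv.Perm (Fin N), g = f ∘ τ := by
  have e (j : J) : Nonempty ({i // g i = j} ≃ {i // f i = j}) := by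
    refine ⟨Fintype.equivOfCardEq ?_⟩
    rw [Fintype.card_subtype, Fintype.card_subtype, h]
  refine ⟨Equiv.ofFiberEquiv fun j => (e j).some, funext fun i => ?_⟩
  exact (Equiv.ofFiberEquiv_map (fun j => (e j).some) i).symm

end PermutationCount

section LetterCount

variable {K : Type*} [DecidableEq K] {N : ℕ}

/-- The number of indices at which a word with letters in `K` and blanks takes the value `k`. -/
def letterCount (f : Fin N → Option K) (k : K) : ℕ :=
  (Finset.univ.filter fun i => f i = some k).card

theorem letterCount_le (f : Fin N → Option K) (k : K) : letterCount f k ≤ N :=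
  (Finset.card_filter_le _ _).trans_eq (Finset.card_fin N)

theorem exists_perm_of_letterCount_eq [Finite K] {f g : Fin N → Option K}
    (h : letterCount f = letterCount g) : ∃ τ : Equiv.Perm (Fin N), g = f ∘ τ := by
  have := Fintype.ofFinite K
  have hblank (f : Fin N → Option K) :
      N = (Finset.univ.filter fun i => f i = none).card + ∑ k, letterCount f k := by
    have := Finset.card_eq_sum_card_fiberwise (s := (Finset.univ : Finset (Fin N)))
      (t := Finset.univ) (f := f) fun _ _ => Finset.mem_coe.2 (Finset.mem_univ _)
    rwa [Fintype.sum_option, Finset.card_fin] at this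
  refine exists_perm_of_card_fiber_eq fun j => ?_
  cases j with
  | some k => exact congrFun h k
  | none =>
    have hf := hblank f
    have hg := hblank g
    rw [h] at hf
    omega

variable [Fintype K]

theorem prod_elim_one_eq_prod_pow_letterCount (q : K → ℝ) (f : Fin N → Option K) :
    ∏ i, (f i).elim 1 q = ∏ k, q k ^ letterCount f k := by
  have hfiber (j : Option K) : ∏ i with f i = j, (f i).elim 1 q =
      j.elim 1 q ^ (Finset.univ.filter fun i => f i = j).card :=
    Finset.prod_eq_pow_card fun i hi => by rw [(Finset.mem_filter.1 hi).2]
  rw [← Finset.prod_fiberwise_of_maps_to (t := Finset.univ) (g := f) fun _ _ => Finset.mem_univ _]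
  simp_rw [hfiber]
  rw [Fintype.prod_option, Option.elim_none, one_pow, one_mul]
  rfl

theorem sum_permCount_self_of_letterCount_eq_le (c : K → ℕ) :
    ∑ f : Fin N → Option K with letterCount f = c, permCount f f ≤ N.factorial := by
  rcases (Finset.univ.filter fun f : Fin N → Option K => letterCount f = c).eq_empty_or_nonempty
    with hempty | ⟨f₀, hf₀⟩
  · rw [hempty, Finset.sum_empty]
    exact Nat.zero_le _
  · have hself : ∀ f ∈ Finset.univ.filter (fun f : Fin N → Option K => letterCount f = c),
        permCount f f = permCount f₀ f := fun f hf => by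
      obtain ⟨τ, rfl⟩ := exists_perm_of_letterCount_eq
        ((Finset.mem_filter.1 hf₀).2.trans (Finset.mem_filter.1 hf).2.symm)
      rw [permCount_comp_left]
    rw [Finset.sum_congr rfl hself, ← sum_permCount f₀]
    exact Finset.sum_le_sum_of_subset (Finset.filter_subset _ _)

theorem sum_prod_pow_le_prod_inv_one_sub {q : K → ℝ} (h0 : ∀ k, 0 ≤ q k) (h1 : ∀ k, q k < 1)
    (N : ℕ) :
    ∑ c ∈ Fintype.piFinset fun _ : K => Finset.range N, ∏ k, q k ^ c k ≤ ∏ k, (1 - q k)⁻¹ := by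
  rw [← Finset.prod_univ_sum]
  refine Finset.prod_le_prod (fun k _ => Finset.sum_nonneg fun c _ => pow_nonneg (h0 k) c)
    fun k _ => ?_
  rw [← tsum_geometric_of_lt_one (h0 k) (h1 k)]
  exact (summable_geometric_of_lt_one (h0 k) (h1 k)).sum_le_tsum _ fun c _ => pow_nonneg (h0 k) c

theorem sum_prod_mul_permCount_self_le {q : K → ℝ} (h0 : ∀ k, 0 ≤ q k) (h1 : ∀ k, q k < 1) :
    ∑ f : Fin N → Option K, (∏ i, (f i).elim 1 q) * permCount f f ≤
      N.factorial * ∏ k, (1 - q k)⁻¹ := by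
  have hrange (f : Fin N → Option K) :
      letterCount f ∈ Fintype.piFinset fun _ : K => Finset.range (N + 1) :=
    Fintype.mem_piFinset.2 fun k => Finset.mem_range_succ_iff.2 (letterCount_le f k)
  rw [← Finset.sum_fiberwise_of_maps_to (g := letterCount) fun f _ => hrange f]
  calc _ ≤ ∑ c ∈ Fintype.piFinset fun _ : K => Finset.range (N + 1),
        N.factorial * ∏ k, q k ^ c k := by
        refine Finset.sum_le_sum fun c _ => ?_
        have hfiber : ∑ f : Fin N → Option K with letterCount f = c,
            (∏ i, (f i).elim 1 q) * (permCount f f : ℝ) =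
            (∑ f : Fin N → Option K with letterCount f = c, (permCount f f : ℝ)) *
              ∏ k, q k ^ c k := by
          rw [Finset.sum_mul]
          refine Finset.sum_congr rfl fun f hf => ?_
          rw [prod_elim_one_eq_prod_pow_letterCount, (Finset.mem_filter.1 hf).2, mul_comm]
        rw [hfiber]
        refine mul_le_mul_of_nonneg_right ?_ (Finset.prod_nonneg fun k _ => pow_nonneg (h0 k) _)
        exact_mod_cast sum_permCount_self_of_letterCount_eq_le c
    _ ≤ _ := by
        rw [← Finset.mul_sum]
        exact mul_le_mul_of_nonneg_left (sum_prod_pow_le_prod_inv_one_sub h0 h1 _) (by positivity)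

end LetterCount

section Orthogonality

variable {Ω ι : Type*} [Fintype ι] {f g : ι → Ω → ℝ}

theorem sum_mul_sum_eq (c d : ι → ℝ) (ω : Ω) :
    (∑ a, c a * f a ω) * ∑ b, d b * g b ω = ∑ a, ∑ b, c a * d b * (f a ω * g b ω) := by
  rw [Finset.sum_mul_sum]
  exact Finset.sum_congr rfl fun a _ => Finset.sum_congr rfl fun b _ => by ring

variable [MeasurableSpace Ω] {P : Measure Ω}

theorem integrable_sum_mul_sum (hint : ∀ a b, Integrable (fun ω => f a ω * g b ω) P)
    (c d : ι → ℝ) : Integrable (fun ω => (∑ a, c a * f a ω) * ∑ b, d b * g b ω) P := by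
  simp_rw [sum_mul_sum_eq]
  exact integrable_finsetSum _ fun a _ => integrable_finsetSum _ fun b _ =>
    (hint a b).const_mul _

theorem integral_sum_mul_sum_of_orthogonal [DecidableEq ι] {m : ι → ℝ}
    (hint : ∀ a b, Integrable (fun ω => f a ω * g b ω) P)
    (horth : ∀ a b, ∫ ω, f a ω * g b ω ∂P = if a = b then m a else 0) (c d : ι → ℝ) :
    ∫ ω, (∑ a, c a * f a ω) * ∑ b, d b * g b ω ∂P = ∑ a, c a * d a * m a := by
  have hi (a b : ι) : Integrable (fun ω => c a * d b * (f a ω * g b ω)) P :=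
    (hint a b).const_mul _
  simp_rw [sum_mul_sum_eq]
  rw [integral_finsetSum _ fun a _ => integrable_finsetSum _ fun b _ => hi a b]
  refine Finset.sum_congr rfl fun a _ => ?_
  rw [integral_finsetSum _ fun b _ => hi a b]
  simp_rw [integral_const_mul, horth, mul_ite, mul_zero, Finset.sum_ite_eq, Finset.mem_univ,
    if_true]

end Orthogonality

section OrthonormalSystem

variable {ι α : Type*} [MeasurableSpace α]

theorem integral_comp_measurePreserving {Ω : Type*} [MeasurableSpace Ω] {P : Measure Ω}
    {μ : Measure α} {X : Ω → α} {f : α → ℝ} (hX : MeasurePreserving X P μ)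
    (hf : AEStronglyMeasurable f μ) : ∫ ω, f (X ω) ∂P = ∫ x, f x ∂μ := by
  rw [← hX.map_eq] at hf ⊢
  exact (integral_map hX.aemeasurable hf).symm

/-- A family of square integrable functions which is orthonormal in `L²(μ)`. Functions are used
instead of classes in `Lp`, so that they can be evaluated at the points of a sample. -/
structure IsOrthonormalSystem [DecidableEq ι] (μ : Measure α) (φ : ι → α → ℝ) : Prop where
  memLp : ∀ i, MemLp (φ i) 2 μ
  integral_mul : ∀ i j, ∫ x, φ i x * φ j x ∂μ = if i = j then 1 else 0

namespace IsOrthonormalSystem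

variable [DecidableEq ι] {μ : Measure α} {φ : ι → α → ℝ}

theorem comp_measurePreserving {Ω : Type*} [MeasurableSpace Ω] {P : Measure Ω} {X : Ω → α}
    (hφ : IsOrthonormalSystem μ φ) (hX : MeasurePreserving X P μ) :
    IsOrthonormalSystem P fun i ω => φ i (X ω) where
  memLp i := (hφ.memLp i).comp_measurePreserving hX
  integral_mul i j := by
    rw [integral_comp_measurePreserving hX (f := fun x => φ i x * φ j x)
      ((hφ.memLp i).1.mul (hφ.memLp j).1), hφ.integral_mul]

theorem integrable_mul (hφ : IsOrthonormalSystem μ φ) (i j : ι) :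
    Integrable (fun x => φ i x * φ j x) μ :=
  (hφ.memLp i).integrable_mul (hφ.memLp j)

theorem comp_injective {κ : Type*} [DecidableEq κ] (hφ : IsOrthonormalSystem μ φ) {e : κ → ι}
    (he : Function.Injective e) : IsOrthonormalSystem μ fun k => φ (e k) where
  memLp k := hφ.memLp (e k)
  integral_mul k l := by simp_rw [hφ.integral_mul, he.eq_iff]

theorem option_elim_one [IsProbabilityMeasure μ] (hφ : IsOrthonormalSystem μ φ)
    (hφ0 : ∀ i, ∫ x, φ i x ∂μ = 0) :
    IsOrthonormalSystem μ fun j : Option ι => j.elim 1 φ where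
  memLp j := by
    cases j with
    | none => exact memLp_const 1
    | some i => exact hφ.memLp i
  integral_mul j l := by
    cases j <;> cases l <;> simp [hφ0, hφ.integral_mul]

theorem pi [IsProbabilityMeasure μ] (hφ : IsOrthonormalSystem μ φ) (N : ℕ) :
    IsOrthonormalSystem (Measure.pi fun _ : Fin N => μ)
      fun (f : Fin N → ι) x => ∏ i, φ (f i) (x i) where
  memLp f := by
    refine (memLp_two_iff_integrable_sq ?_).2 ?_
    · exact Finset.aestronglyMeasurable_fun_prod _ fun i _ =>
        (hφ.memLp (f i)).1.comp_quasiMeasurePreserving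
          (measurePreserving_eval _ i).quasiMeasurePreserving
    · simp_rw [← Finset.prod_pow]
      exact Integrable.fintype_prod (f := fun i x => φ (f i) x ^ 2) fun i =>
        (hφ.memLp (f i)).integrable_sq
  integral_mul f g := by
    simp_rw [← Finset.prod_mul_distrib]
    rw [integral_fintype_prod_eq_prod fun i x => φ (f i) x * φ (g i) x]
    simp_rw [hφ.integral_mul, Finset.prod_ite_zero, Finset.prod_const_one, Finset.mem_univ,
      true_imp_iff, funext_iff]

theorem prod {κ β : Type*} [MeasurableSpace β] [DecidableEq κ] {ν : Measure β}
    [SFinite μ] [SFinite ν] {ψ : κ → β → ℝ} (hφ : IsOrthonormalSystem μ φ)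
    (hψ : IsOrthonormalSystem ν ψ) :
    IsOrthonormalSystem (μ.prod ν) fun (a : ι × κ) z => φ a.1 z.1 * ψ a.2 z.2 where
  memLp a := (memLp_two_iff_integrable_sq
      ((hφ.memLp a.1).1.comp_fst.mul (hψ.memLp a.2).1.comp_snd)).2 <| by
    simpa only [Pi.mul_apply, mul_pow] using
      (hφ.memLp a.1).integrable_sq.mul_prod (hψ.memLp a.2).integrable_sq
  integral_mul a b := by
    simp_rw [mul_mul_mul_comm]
    rw [integral_prod_mul (fun x => φ a.1 x * φ b.1 x) fun y => ψ a.2 y * ψ b.2 y,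
      hφ.integral_mul, hψ.integral_mul, ite_zero_mul_ite_zero, mul_one]
    simp_rw [Prod.ext_iff]

theorem integral_sum_sq [Fintype ι] (hφ : IsOrthonormalSystem μ φ) (c : ι → ℝ) :
    ∫ x, (∑ i, c i * φ i x) ^ 2 ∂μ = ∑ i, c i ^ 2 := by
  simp_rw [sq]
  rw [integral_sum_mul_sum_of_orthogonal (m := fun _ => 1) hφ.integrable_mul hφ.integral_mul]
  simp_rw [mul_one]

theorem memLp_sum [Fintype ι] (hφ : IsOrthonormalSystem μ φ) (c : ι → ℝ) :
    MemLp (fun x => ∑ i, c i * φ i x) 2 μ :=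
  memLp_finsetSum _ fun i _ => (hφ.memLp i).const_mul (c i)

theorem integral_sub_sum_sq [Fintype ι] (hφ : IsOrthonormalSystem μ φ) {f : α → ℝ}
    (hf : MemLp f 2 μ) {c : ι → ℝ} (hc : ∀ i, ∫ x, f x * φ i x ∂μ = c i) :
    ∫ x, (f x - ∑ i, c i * φ i x) ^ 2 ∂μ = ∫ x, f x ^ 2 ∂μ - ∑ i, c i ^ 2 := by
  have hcross : ∫ x, f x * ∑ i, c i * φ i x ∂μ = ∑ i, c i ^ 2 := by
    simp_rw [Finset.mul_sum, mul_left_comm (f _)]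
    have hint (i : ι) : Integrable (fun x => c i * (f x * φ i x)) μ :=
      (hf.integrable_mul (hφ.memLp i)).const_mul (c i)
    rw [integral_finsetSum _ fun i _ => hint i]
    simp_rw [integral_const_mul, hc, sq]
  have hfφ : Integrable (fun x => 2 * (f x * ∑ i, c i * φ i x)) μ :=
    (hf.integrable_mul (hφ.memLp_sum c)).const_mul 2
  have hdiff : Integrable (fun x => f x ^ 2 - 2 * (f x * ∑ i, c i * φ i x)) μ :=
    hf.integrable_sq.sub hfφ
  simp_rw [sub_sq, mul_assoc (2 : ℝ)]
  rw [integral_add hdiff (hφ.memLp_sum c).integrable_sq, integral_sub hf.integrable_sq hfφ,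
    integral_const_mul, hcross, hφ.integral_sum_sq]
  ring

end IsOrthonormalSystem

end OrthonormalSystem

section SecondMoment

variable {α β : Type*}

theorem pairingAverage_sum_mul_eq {J : Type*} [Fintype J] [DecidableEq J] (t : J → ℝ)
    (φ : J → α → ℝ) (ψ : J → β → ℝ) (N : ℕ) (z : (Fin N → α) × (Fin N → β)) :
    pairingAverage (fun w => ∑ j, t j * (φ j w.1 * ψ j w.2)) N z =
      ∑ a : (Fin N → J) × (Fin N → J),
        ((N.factorial : ℝ)⁻¹ * ((∏ i, t (a.1 i)) * permCount a.1 a.2)) *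
          ((∏ i, φ (a.1 i) (z.1 i)) * ∏ i, ψ (a.2 i) (z.2 i)) := by
  have hexpand (σ : Equiv.Perm (Fin N)) :
      ∏ i, ∑ j, t j * (φ j (z.1 i) * ψ j (z.2 (σ⁻¹ i))) =
        ∑ f : Fin N → J, (∏ i, t (f i)) * ((∏ i, φ (f i) (z.1 i)) *
          ∏ i, ψ ((f ∘ σ) i) (z.2 i)) := by
    rw [Finset.prod_univ_sum, Fintype.piFinset_univ]
    refine Finset.sum_congr rfl fun f _ => ?_
    rw [Finset.prod_mul_distrib, Finset.prod_mul_distrib,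
      ← Equiv.prod_comp σ fun i => ψ (f i) (z.2 (σ⁻¹ i))]
    simp only [Equiv.Perm.coe_inv, Equiv.symm_apply_apply, Function.comp_apply]
  rw [pairingAverage, ← Equiv.sum_comp (Equiv.inv (Equiv.Perm (Fin N)))]
  simp only [Equiv.inv_apply]
  simp_rw [hexpand]
  rw [Finset.sum_comm, Fintype.sum_prod_type, Finset.mul_sum]
  refine Finset.sum_congr rfl fun f _ => ?_
  rw [sum_perm_comp_eq_sum_permCount f fun g =>
    (∏ i, t (f i)) * ((∏ i, φ (f i) (z.1 i)) * ∏ i, ψ (g i) (z.2 i)), Finset.mul_sum]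
  refine Finset.sum_congr rfl fun g _ => ?_
  rw [nsmul_eq_mul]
  ring

theorem sum_sq_prod_mul_permCount {J : Type*} [Fintype J] [DecidableEq J] (t : J → ℝ) (N : ℕ) :
    ∑ a : (Fin N → J) × (Fin N → J),
        ((N.factorial : ℝ)⁻¹ * ((∏ i, t (a.1 i)) * permCount a.1 a.2)) ^ 2 =
      (N.factorial : ℝ)⁻¹ * ∑ f : Fin N → J, (∏ i, t (f i) ^ 2) * permCount f f := by
  rw [Fintype.sum_prod_type, Finset.mul_sum]
  refine Finset.sum_congr rfl fun f _ => ?_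
  have hcount : ∑ g, (permCount f g : ℝ) ^ 2 = N.factorial * permCount f f := by
    exact_mod_cast sum_permCount_sq f
  simp_rw [mul_pow]
  rw [← Finset.mul_sum, ← Finset.mul_sum, ← Finset.prod_pow, hcount]
  field_simp

variable {K : Type*} [Fintype K]

/-- The kernel `1 + ∑ s_k φ_k ⊗ ψ_k` of finite rank. -/
noncomputable def finiteRankKernel (s : K → ℝ) (φ : K → α → ℝ) (ψ : K → β → ℝ) (w : α × β) : ℝ :=
  1 + ∑ k, s k * (φ k w.1 * ψ k w.2)

theorem finiteRankKernel_eq_sum_option (s : K → ℝ) (φ : K → α → ℝ) (ψ : K → β → ℝ) :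
    finiteRankKernel s φ ψ = fun w =>
      ∑ j : Option K, j.elim 1 s * (j.elim 1 φ w.1 * j.elim 1 ψ w.2) := by
  ext w
  simp [finiteRankKernel, Fintype.sum_option]

variable [MeasurableSpace α] [MeasurableSpace β] {μ : Measure α} {ν : Measure β}
  [IsProbabilityMeasure μ] [IsProbabilityMeasure ν] [DecidableEq K] {s : K → ℝ}
  {φ : K → α → ℝ} {ψ : K → β → ℝ}

theorem memLp_pairingAverage_finiteRankKernel (hφ : IsOrthonormalSystem μ φ)
    (hφ0 : ∀ k, ∫ x, φ k x ∂μ = 0) (hψ : IsOrthonormalSystem ν ψ) (hψ0 : ∀ k, ∫ y, ψ k y ∂ν = 0)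
    (N : ℕ) : MemLp (pairingAverage (finiteRankKernel s φ ψ) N) 2 (indepSampleLaw μ ν N) := by
  rw [finiteRankKernel_eq_sum_option, funext (pairingAverage_sum_mul_eq _ _ _ N)]
  exact (((hφ.option_elim_one hφ0).pi N).prod ((hψ.option_elim_one hψ0).pi N)).memLp_sum _

theorem integral_pairingAverage_finiteRankKernel_sq_le (hφ : IsOrthonormalSystem μ φ)
    (hφ0 : ∀ k, ∫ x, φ k x ∂μ = 0) (hψ : IsOrthonormalSystem ν ψ) (hψ0 : ∀ k, ∫ y, ψ k y ∂ν = 0)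
    (hs : ∀ k, s k ^ 2 < 1) (N : ℕ) :
    ∫ z, pairingAverage (finiteRankKernel s φ ψ) N z ^ 2 ∂indepSampleLaw μ ν N ≤
      ∏ k, (1 - s k ^ 2)⁻¹ := by
  have hsq (j : Option K) : j.elim 1 s ^ 2 = j.elim 1 fun k => s k ^ 2 := by
    cases j <;> simp
  rw [finiteRankKernel_eq_sum_option, funext (pairingAverage_sum_mul_eq _ _ _ N),
    (((hφ.option_elim_one hφ0).pi N).prod ((hψ.option_elim_one hψ0).pi N)).integral_sum_sq,
    sum_sq_prod_mul_permCount (fun j : Option K => j.elim 1 s), inv_mul_le_iff₀ (by positivity)]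
  simp_rw [hsq]
  exact sum_prod_mul_permCount_self_le (fun k => sq_nonneg _) hs

end SecondMoment

section Mehler

open ProbabilityTheory

/-- The density, with respect to the standard Gaussian measure of the plane, of the centred
Gaussian measure with unit variances and correlation `s`. -/
noncomputable def mehlerKernel (s : ℝ) (p : ℝ × ℝ) : ℝ :=
  (√(1 - s ^ 2))⁻¹ *
    Real.exp (-(s ^ 2 * p.1 ^ 2 - 2 * s * p.1 * p.2 + s ^ 2 * p.2 ^ 2) / (2 * (1 - s ^ 2)))

/-- The standard Gaussian measure of the plane. -/
noncomputable abbrev gaussianPlane : Measure (ℝ × ℝ) := (gaussianReal 0 1).prod (gaussianReal 0 1)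

/-- The centred Gaussian measure of the plane with unit variances and correlation `s`. -/
noncomputable def correlatedGaussian (s : ℝ) : Measure (ℝ × ℝ) :=
  gaussianPlane.map fun p => (p.1, s * p.1 + √(1 - s ^ 2) * p.2)

instance (s : ℝ) : IsProbabilityMeasure (correlatedGaussian s) :=
  Measure.isProbabilityMeasure_map (by fun_prop)

theorem correlatedGaussian_zero : correlatedGaussian 0 = gaussianPlane := by
  simp [correlatedGaussian]

theorem continuous_mehlerKernel (s : ℝ) : Continuous (mehlerKernel s) := by
  unfold mehlerKernel
  fun_prop

variable {s : ℝ}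

theorem mehlerKernel_pos (hs : s ^ 2 < 1) (p : ℝ × ℝ) : 0 < mehlerKernel s p :=
  mul_pos (inv_pos.2 (Real.sqrt_pos.2 (by linarith))) (Real.exp_pos _)

theorem mehlerKernel_mul_gaussianPDFReal (hs : s ^ 2 < 1) (u v : ℝ) :
    mehlerKernel s (u, v) * gaussianPDFReal 0 1 v =
      gaussianPDFReal (s * u) (1 - s ^ 2).toNNReal v := by
  have h : 0 < 1 - s ^ 2 := by linarith
  simp only [mehlerKernel, gaussianPDFReal, NNReal.coe_one, Real.coe_toNNReal _ h.le]
  rw [Real.sqrt_mul (by positivity) (1 - s ^ 2), mul_one, mul_inv, mul_mul_mul_comm, ← Real.exp_add,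
    mul_comm (√(1 - s ^ 2))⁻¹]
  congr 2
  field_simp
  ring

theorem gaussianReal_map_affine (hs : s ^ 2 < 1) (u : ℝ) :
    (gaussianReal 0 1).map (fun z => s * u + √(1 - s ^ 2) * z) =
      gaussianReal (s * u) (1 - s ^ 2).toNNReal := by
  have hcomp : (fun z => s * u + √(1 - s ^ 2) * z) = (s * u + ·) ∘ (√(1 - s ^ 2) * ·) := rfl
  rw [hcomp, ← Measure.map_map (by fun_prop) (by fun_prop), gaussianReal_map_const_mul,
    gaussianReal_map_const_add, mul_zero, zero_add, mul_one]
  congr 1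
  ext
  have h : 0 ≤ 1 - s ^ 2 := by linarith
  rw [Real.coe_toNNReal _ h]
  exact Real.sq_sqrt h

theorem lintegral_gaussianReal {m : ℝ} {v : NNReal} (hv : v ≠ 0) {f : ℝ → ℝ≥0∞}
    (hf : Measurable f) :
    ∫⁻ x, f x ∂gaussianReal m v = ∫⁻ x, ENNReal.ofReal (gaussianPDFReal m v x) * f x := by
  rw [gaussianReal_of_var_ne_zero _ hv,
    lintegral_withDensity_eq_lintegral_mul _ (measurable_gaussianPDF m v) hf]
  rfl

theorem correlatedGaussian_eq_withDensity (hs : s ^ 2 < 1) :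
    correlatedGaussian s =
      gaussianPlane.withDensity fun p => ENNReal.ofReal (mehlerKernel s p) := by
  have hm : Measurable (mehlerKernel s) := (continuous_mehlerKernel s).measurable
  have hv : (1 - s ^ 2).toNNReal ≠ 0 := (Real.toNNReal_pos.2 (by linarith)).ne'
  refine Measure.ext_of_lintegral _ fun f hf => ?_
  rw [correlatedGaussian, lintegral_map hf (by fun_prop),
    lintegral_withDensity_eq_lintegral_mul _ (by fun_prop) hf,
    lintegral_prod _ (by fun_prop), lintegral_prod _ (by fun_prop)]
  refine lintegral_congr fun u => ?_
  have hfiber := lintegral_map (μ := gaussianReal 0 1) (f := fun v => f (u, v))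
    (g := fun z => s * u + √(1 - s ^ 2) * z) (by fun_prop) (by fun_prop)
  rw [gaussianReal_map_affine hs, lintegral_gaussianReal hv (by fun_prop)] at hfiber
  rw [← hfiber, lintegral_gaussianReal one_ne_zero (by fun_prop)]
  refine lintegral_congr fun v => ?_
  rw [← mehlerKernel_mul_gaussianPDFReal hs, ENNReal.ofReal_mul (mehlerKernel_pos hs _).le,
    Pi.mul_apply]
  ring

theorem charFun_correlatedGaussian (hs : s ^ 2 < 1) (a b : ℝ) :
    ∫ p, Complex.exp ((a * p.1 + b * p.2 : ℝ) * Complex.I) ∂correlatedGaussian s =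
      Complex.exp (-((a ^ 2 + 2 * s * a * b + b ^ 2 : ℝ) : ℂ) / 2) := by
  have hsplit (p : ℝ × ℝ) : Complex.exp (((a * p.1 + b * (s * p.1 + √(1 - s ^ 2) * p.2) : ℝ) : ℂ) *
      Complex.I) = Complex.exp ((a + b * s : ℝ) * p.1 * Complex.I) *
        Complex.exp ((b * √(1 - s ^ 2) : ℝ) * p.2 * Complex.I) := by
    rw [← Complex.exp_add]
    congr 1
    push_cast
    ring
  rw [correlatedGaussian, integral_map (by fun_prop) (by fun_prop)]
  simp only [hsplit]
  rw [integral_prod_mul (fun u : ℝ => Complex.exp ((a + b * s : ℝ) * u * Complex.I))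
    (fun u : ℝ => Complex.exp ((b * √(1 - s ^ 2) : ℝ) * u * Complex.I)),
    ← charFun_apply_real, ← charFun_apply_real, charFun_gaussianReal, charFun_gaussianReal,
    ← Complex.exp_add]
  congr 1
  have hsqrt : ((√(1 - s ^ 2) : ℝ) : ℂ) ^ 2 = 1 - (s : ℂ) ^ 2 := by
    rw [← Complex.ofReal_pow, Real.sq_sqrt (by linarith)]
    push_cast
    ring
  push_cast
  rw [mul_pow, hsqrt]
  ring

-- Completing the square in `v`, then in `u`.
theorem gaussianPDFReal_mul_mehlerKernel_sq (hs : s ^ 2 < 1) (u v : ℝ) :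
    gaussianPDFReal 0 1 u * (gaussianPDFReal 0 1 v * mehlerKernel s (u, v) ^ 2) =
      (1 - s ^ 2)⁻¹ * (gaussianPDFReal 0 ((1 + s ^ 2) / (1 - s ^ 2)).toNNReal u *
        gaussianPDFReal (2 * s * u / (1 + s ^ 2)) ((1 - s ^ 2) / (1 + s ^ 2)).toNNReal v) := by
  have h : 0 < 1 - s ^ 2 := by linarith
  have h' : 0 < 1 + s ^ 2 := by positivity
  simp only [mehlerKernel, gaussianPDFReal, NNReal.coe_one,
    Real.coe_toNNReal _ (div_pos h h').le, Real.coe_toNNReal _ (div_pos h' h).le]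
  rw [mul_pow, inv_pow, Real.sq_sqrt h.le, ← Real.exp_nat_mul]
  have hconst : (√(2 * Real.pi * 1))⁻¹ * (√(2 * Real.pi * 1))⁻¹ =
      (√(2 * Real.pi * ((1 + s ^ 2) / (1 - s ^ 2))))⁻¹ *
        (√(2 * Real.pi * ((1 - s ^ 2) / (1 + s ^ 2))))⁻¹ := by
    rw [← mul_inv, ← mul_inv, ← Real.sqrt_mul (by positivity), ← Real.sqrt_mul (by positivity)]
    congr 2
    field_simp
  have hexp : -(u - 0) ^ 2 / (2 * 1) + (-(v - 0) ^ 2 / (2 * 1) + (2 : ℕ) *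
      (-(s ^ 2 * u ^ 2 - 2 * s * u * v + s ^ 2 * v ^ 2) / (2 * (1 - s ^ 2)))) =
      -(u - 0) ^ 2 / (2 * ((1 + s ^ 2) / (1 - s ^ 2))) +
        -(v - 2 * s * u / (1 + s ^ 2)) ^ 2 / (2 * ((1 - s ^ 2) / (1 + s ^ 2))) := by
    push_cast
    field_simp
    ring
  have hexp' := congrArg Real.exp hexp
  simp only [Real.exp_add] at hexp'
  linear_combination (1 - s ^ 2)⁻¹ * (√(2 * Real.pi * 1))⁻¹ * (√(2 * Real.pi * 1))⁻¹ * hexp' +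
    (1 - s ^ 2)⁻¹ * Real.exp (-(u - 0) ^ 2 / (2 * ((1 + s ^ 2) / (1 - s ^ 2)))) *
      Real.exp (-(v - 2 * s * u / (1 + s ^ 2)) ^ 2 / (2 * ((1 - s ^ 2) / (1 + s ^ 2)))) * hconst

theorem lintegral_mehlerKernel_sq (hs : s ^ 2 < 1) :
    ∫⁻ p, ENNReal.ofReal (mehlerKernel s p ^ 2) ∂gaussianPlane =
      ENNReal.ofReal (1 - s ^ 2)⁻¹ := by
  have h : 0 < 1 - s ^ 2 := by linarith
  have hm : Measurable (mehlerKernel s) := (continuous_mehlerKernel s).measurable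
  have hv : ((1 - s ^ 2) / (1 + s ^ 2)).toNNReal ≠ 0 := (Real.toNNReal_pos.2 (by positivity)).ne'
  have hv' : ((1 + s ^ 2) / (1 - s ^ 2)).toNNReal ≠ 0 := (Real.toNNReal_pos.2 (by positivity)).ne'
  rw [lintegral_prod _ (by fun_prop), lintegral_gaussianReal one_ne_zero (by fun_prop)]
  calc _ = ∫⁻ u, ENNReal.ofReal (1 - s ^ 2)⁻¹ *
        ENNReal.ofReal (gaussianPDFReal 0 ((1 + s ^ 2) / (1 - s ^ 2)).toNNReal u) := by
        refine lintegral_congr fun u => ?_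
        rw [lintegral_gaussianReal one_ne_zero (by fun_prop),
          ← lintegral_const_mul _ (by fun_prop)]
        simp_rw [← ENNReal.ofReal_mul (gaussianPDFReal_nonneg _ _ _),
          gaussianPDFReal_mul_mehlerKernel_sq hs, ENNReal.ofReal_mul (inv_nonneg.2 h.le),
          ENNReal.ofReal_mul (gaussianPDFReal_nonneg _ _ _), ← mul_assoc]
        rw [lintegral_const_mul _ (by fun_prop), lintegral_gaussianPDFReal_eq_one _ hv, mul_one]
    _ = _ := by
        rw [lintegral_const_mul _ (by fun_prop), lintegral_gaussianPDFReal_eq_one _ hv', mul_one]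

theorem integrable_mehlerKernel_sq (hs : s ^ 2 < 1) :
    Integrable (fun p => mehlerKernel s p ^ 2) gaussianPlane := by
  refine ⟨((continuous_mehlerKernel s).pow 2).aestronglyMeasurable, ?_⟩
  rw [hasFiniteIntegral_iff_ofReal (.of_forall fun _ => sq_nonneg _), lintegral_mehlerKernel_sq hs]
  exact ENNReal.ofReal_lt_top

theorem integral_mehlerKernel_sq (hs : s ^ 2 < 1) :
    ∫ p, mehlerKernel s p ^ 2 ∂gaussianPlane = (1 - s ^ 2)⁻¹ := by
  rw [integral_eq_lintegral_of_nonneg_ae (.of_forall fun _ => sq_nonneg _)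
    ((continuous_mehlerKernel s).pow 2).aestronglyMeasurable, lintegral_mehlerKernel_sq hs,
    ENNReal.toReal_ofReal (inv_nonneg.2 (by linarith))]

end Mehler

section LogMehler

open ProbabilityTheory

theorem integrable_sq_gaussianReal : Integrable (fun x : ℝ => x ^ 2) (gaussianReal 0 1) :=
  (memLp_id_gaussianReal 2).integrable_sq

theorem integral_sq_gaussianReal : ∫ x : ℝ, x ^ 2 ∂gaussianReal 0 1 = 1 := by
  have h := variance_fun_id_gaussianReal (μ := 0) (v := 1)
  rw [variance_eq_integral measurable_id'.aemeasurable, integral_id_gaussianReal] at h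
  simpa using h

theorem integrable_mul_gaussianPlane : Integrable (fun p : ℝ × ℝ => p.1 * p.2) gaussianPlane :=
  have h : Integrable (fun x : ℝ => x) (gaussianReal 0 1) :=
    (memLp_id_gaussianReal 1).integrable le_rfl
  h.mul_prod h

theorem integrable_quadratic_gaussianPlane (a b c : ℝ) :
    Integrable (fun p : ℝ × ℝ => a * p.1 ^ 2 + b * (p.1 * p.2) + c * p.2 ^ 2) gaussianPlane :=
  (((integrable_sq_gaussianReal.comp_fst _).const_mul a).add
    (integrable_mul_gaussianPlane.const_mul b)).add
    ((integrable_sq_gaussianReal.comp_snd _).const_mul c)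

theorem integral_quadratic_gaussianPlane (a b c : ℝ) :
    ∫ p : ℝ × ℝ, (a * p.1 ^ 2 + b * (p.1 * p.2) + c * p.2 ^ 2) ∂gaussianPlane = a + c := by
  have h1 : Integrable (fun p : ℝ × ℝ => a * p.1 ^ 2) gaussianPlane :=
    (integrable_sq_gaussianReal.comp_fst _).const_mul a
  have h12 : Integrable (fun p : ℝ × ℝ => b * (p.1 * p.2)) gaussianPlane :=
    integrable_mul_gaussianPlane.const_mul b
  have h2 : Integrable (fun p : ℝ × ℝ => c * p.2 ^ 2) gaussianPlane :=
    (integrable_sq_gaussianReal.comp_snd _).const_mul c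
  have h112 : Integrable (fun p : ℝ × ℝ => a * p.1 ^ 2 + b * (p.1 * p.2)) gaussianPlane :=
    h1.add h12
  rw [integral_add h112 h2, integral_add h1 h12, integral_const_mul, integral_const_mul,
    integral_const_mul, integral_prod_mul (fun x : ℝ => x) (fun x : ℝ => x),
    integral_fun_fst (fun x : ℝ => x ^ 2), integral_fun_snd (fun x : ℝ => x ^ 2),
    integral_sq_gaussianReal, integral_id_gaussianReal]
  simp

variable {s : ℝ}

theorem neg_log_mehlerKernel (hs : s ^ 2 < 1) (p : ℝ × ℝ) :
    -Real.log (mehlerKernel s p) = Real.log (√(1 - s ^ 2)) +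
      (s ^ 2 / (2 * (1 - s ^ 2)) * p.1 ^ 2 + -(s / (1 - s ^ 2)) * (p.1 * p.2) +
        s ^ 2 / (2 * (1 - s ^ 2)) * p.2 ^ 2) := by
  have h : 0 < 1 - s ^ 2 := by linarith
  rw [mehlerKernel, Real.log_mul (inv_ne_zero (Real.sqrt_ne_zero'.2 h)) (Real.exp_ne_zero _),
    Real.log_exp, Real.log_inv]
  field_simp
  ring

theorem integrable_neg_log_mehlerKernel (hs : s ^ 2 < 1) :
    Integrable (fun p => -Real.log (mehlerKernel s p)) gaussianPlane := by
  simp_rw [neg_log_mehlerKernel hs]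
  exact (integrable_const _).add (integrable_quadratic_gaussianPlane _ _ _)

theorem integral_neg_log_mehlerKernel_le (hs : s ^ 2 < 1) :
    ∫ p, -Real.log (mehlerKernel s p) ∂gaussianPlane ≤ s ^ 2 / (1 - s ^ 2) := by
  have hlog : Real.log (√(1 - s ^ 2)) ≤ 0 :=
    Real.log_nonpos (Real.sqrt_nonneg _) (Real.sqrt_le_one.2 (by nlinarith))
  have hsum : s ^ 2 / (2 * (1 - s ^ 2)) + s ^ 2 / (2 * (1 - s ^ 2)) = s ^ 2 / (1 - s ^ 2) := by
    rw [← add_div, ← two_mul, mul_div_mul_left _ _ two_ne_zero]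
  simp_rw [neg_log_mehlerKernel hs]
  rw [integral_add (integrable_const _) (integrable_quadratic_gaussianPlane _ _ _),
    integral_quadratic_gaussianPlane, hsum, integral_const, probReal_univ, one_smul]
  linarith

end LogMehler

section MehlerProduct

open ProbabilityTheory

variable {K : Type*} [Fintype K] {s : K → ℝ}

/-- The law of a finite family of independent pairs of standard Gaussian variables. -/
noncomputable abbrev gaussianPairs (K : Type*) [Fintype K] : Measure (K → ℝ × ℝ) :=
  Measure.pi fun _ => gaussianPlane

/-- The likelihood ratio, with respect to `gaussianPairs K`, of a family of independent pairs of
standard Gaussian variables with correlations `s k`. -/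
noncomputable def mehlerProd (s : K → ℝ) (x : K → ℝ × ℝ) : ℝ := ∏ k, mehlerKernel (s k) (x k)

theorem continuous_mehlerProd (s : K → ℝ) : Continuous (mehlerProd s) :=
  continuous_finsetProd _ fun k _ => (continuous_mehlerKernel (s k)).comp (continuous_apply k)

theorem mehlerProd_pos (hs : ∀ k, s k ^ 2 < 1) (x : K → ℝ × ℝ) : 0 < mehlerProd s x :=
  Finset.prod_pos fun k _ => mehlerKernel_pos (hs k) _

theorem pi_correlatedGaussian (hs : ∀ k, s k ^ 2 < 1) :
    Measure.pi (fun k => correlatedGaussian (s k)) =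
      (gaussianPairs K).withDensity fun x => ENNReal.ofReal (mehlerProd s x) := by
  have hsf (k : K) : SigmaFinite (gaussianPlane.withDensity
      fun p => ENNReal.ofReal (mehlerKernel (s k) p)) := by
    rw [← correlatedGaussian_eq_withDensity (hs k)]
    infer_instance
  have h := pi_withDensity (fun _ : K => gaussianPlane) fun k =>
    (continuous_mehlerKernel (s k)).measurable.ennreal_ofReal
  simp_rw [← correlatedGaussian_eq_withDensity (hs _)] at h
  rw [h]
  simp_rw [mehlerProd, ENNReal.ofReal_prod_of_nonneg fun k _ => (mehlerKernel_pos (hs k) _).le]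

theorem integral_pi_correlatedGaussian (hs : ∀ k, s k ^ 2 < 1) (h : (K → ℝ × ℝ) → ℝ) :
    ∫ x, h x ∂Measure.pi (fun k => correlatedGaussian (s k)) =
      ∫ x, mehlerProd s x * h x ∂gaussianPairs K := by
  rw [pi_correlatedGaussian hs, integral_withDensity_eq_integral_toReal_smul
    (continuous_mehlerProd s).measurable.ennreal_ofReal
    (.of_forall fun _ => ENNReal.ofReal_lt_top)]
  simp_rw [ENNReal.toReal_ofReal (mehlerProd_pos hs _).le, smul_eq_mul]

theorem integrable_mehlerProd_sq (hs : ∀ k, s k ^ 2 < 1) :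
    Integrable (fun x => mehlerProd s x ^ 2) (gaussianPairs K) := by
  simp_rw [mehlerProd, ← Finset.prod_pow]
  exact Integrable.fintype_prod (f := fun k p => mehlerKernel (s k) p ^ 2)
    fun k => integrable_mehlerKernel_sq (hs k)

theorem integral_mehlerProd_sq (hs : ∀ k, s k ^ 2 < 1) :
    ∫ x, mehlerProd s x ^ 2 ∂gaussianPairs K = ∏ k, (1 - s k ^ 2)⁻¹ := by
  simp_rw [mehlerProd, ← Finset.prod_pow]
  rw [integral_fintype_prod_eq_prod (fun k p => mehlerKernel (s k) p ^ 2)]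
  simp_rw [integral_mehlerKernel_sq (hs _)]

theorem memLp_mehlerProd (hs : ∀ k, s k ^ 2 < 1) : MemLp (mehlerProd s) 2 (gaussianPairs K) :=
  (memLp_two_iff_integrable_sq (continuous_mehlerProd s).aestronglyMeasurable).2
    (integrable_mehlerProd_sq hs)

theorem integrable_mehlerProd (hs : ∀ k, s k ^ 2 < 1) :
    Integrable (mehlerProd s) (gaussianPairs K) :=
  (memLp_mehlerProd hs).integrable one_le_two

theorem integral_mehlerProd (hs : ∀ k, s k ^ 2 < 1) :
    ∫ x, mehlerProd s x ∂gaussianPairs K = 1 := by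
  simpa using (integral_pi_correlatedGaussian hs fun _ => 1).symm

theorem neg_log_mehlerProd (hs : ∀ k, s k ^ 2 < 1) (x : K → ℝ × ℝ) :
    -Real.log (mehlerProd s x) = ∑ k, -Real.log (mehlerKernel (s k) (x k)) := by
  rw [mehlerProd, Real.log_prod fun k _ => (mehlerKernel_pos (hs k) _).ne',
    Finset.sum_neg_distrib]

theorem integrable_neg_log_mehlerKernel_eval (hs : ∀ k, s k ^ 2 < 1) (k : K) :
    Integrable (fun x : K → ℝ × ℝ => -Real.log (mehlerKernel (s k) (x k))) (gaussianPairs K) :=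
  integrable_comp_eval (μ := fun _ : K => gaussianPlane) (i := k)
    (f := fun p => -Real.log (mehlerKernel (s k) p)) (integrable_neg_log_mehlerKernel (hs k))

theorem integrable_neg_log_mehlerProd (hs : ∀ k, s k ^ 2 < 1) :
    Integrable (fun x => -Real.log (mehlerProd s x)) (gaussianPairs K) := by
  simp_rw [neg_log_mehlerProd hs]
  exact integrable_finsetSum _ fun k _ => integrable_neg_log_mehlerKernel_eval hs k

theorem integral_neg_log_mehlerProd_le (hs : ∀ k, s k ^ 2 < 1) :
    ∫ x, -Real.log (mehlerProd s x) ∂gaussianPairs K ≤ ∑ k, s k ^ 2 / (1 - s k ^ 2) := by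
  simp_rw [neg_log_mehlerProd hs]
  rw [integral_finsetSum _ fun k _ => integrable_neg_log_mehlerKernel_eval hs k]
  refine Finset.sum_le_sum fun k _ => ?_
  rw [integral_comp_eval (μ := fun _ : K => gaussianPlane) (i := k)
    (f := fun p => -Real.log (mehlerKernel (s k) p))
    (integrable_neg_log_mehlerKernel (hs k)).aestronglyMeasurable]
  exact integral_neg_log_mehlerKernel_le (hs k)

-- Markov's inequality is applied to `F - log F`, which is nonnegative, where `- log F` is not.
theorem measureReal_mehlerProd_le (hs : ∀ k, s k ^ 2 < 1) {η : ℝ} (h0 : 0 < η) (h1 : η < 1) :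
    (gaussianPairs K).real {x | mehlerProd s x ≤ η} ≤
      (∑ k, s k ^ 2 / (1 - s k ^ 2) + 1) / Real.log η⁻¹ := by
  have hlog : 0 < Real.log η⁻¹ := Real.log_pos ((one_lt_inv₀ h0).2 h1)
  have hnonneg (x : K → ℝ × ℝ) : 0 ≤ -Real.log (mehlerProd s x) + mehlerProd s x := by
    have := Real.log_le_sub_one_of_pos (mehlerProd_pos hs x)
    linarith
  rw [le_div_iff₀' hlog]
  calc Real.log η⁻¹ * (gaussianPairs K).real {x | mehlerProd s x ≤ η}
      ≤ Real.log η⁻¹ * (gaussianPairs K).real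
          {x | Real.log η⁻¹ ≤ -Real.log (mehlerProd s x) + mehlerProd s x} := by
        refine mul_le_mul_of_nonneg_left (measureReal_mono fun x hx => ?_) hlog.le
        have hle : Real.log (mehlerProd s x) ≤ Real.log η :=
          Real.log_le_log (mehlerProd_pos hs x) hx
        have hpos := mehlerProd_pos hs x
        rw [Set.mem_ofPred_eq, Real.log_inv]
        linarith
    _ ≤ ∫ x, (-Real.log (mehlerProd s x) + mehlerProd s x) ∂gaussianPairs K :=
        mul_meas_ge_le_integral_of_nonneg (.of_forall hnonneg)
          ((integrable_neg_log_mehlerProd hs).add (integrable_mehlerProd hs)) _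
    _ ≤ _ := by
        rw [integral_add (integrable_neg_log_mehlerProd hs) (integrable_mehlerProd hs),
          integral_mehlerProd hs]
        exact add_le_add_left (integral_neg_log_mehlerProd_le hs) 1

end MehlerProduct

section Truncation

variable {Ω : Type*} [MeasurableSpace Ω] {P : Measure Ω} {f : Ω → ℝ}

theorem tendsto_integral_min_natCast_sq (hf : MemLp f 2 P) (hf0 : ∀ x, 0 ≤ f x) :
    Tendsto (fun n : ℕ => ∫ x, min (f x) n ^ 2 ∂P) atTop (𝓝 (∫ x, f x ^ 2 ∂P)) := by
  refine tendsto_integral_of_dominated_convergence (fun x => f x ^ 2)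
    (fun n => (hf.1.inf aestronglyMeasurable_const).pow 2) hf.integrable_sq
    (fun n => .of_forall fun x => ?_) (.of_forall fun x => ?_)
  · rw [Real.norm_eq_abs, abs_of_nonneg (sq_nonneg _)]
    exact pow_le_pow_left₀ (le_min (hf0 x) (Nat.cast_nonneg n)) (min_le_left _ _) 2
  · refine tendsto_const_nhds.congr' ?_
    obtain ⟨n, hn⟩ := exists_nat_ge (f x)
    filter_upwards [eventually_ge_atTop n] with m hm
    rw [min_eq_left (hn.trans (Nat.cast_le.2 hm))]

end Truncation

section CentralLimit

open ProbabilityTheory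

variable {Ω : Type*} [MeasurableSpace Ω] {π : Measure Ω} [IsProbabilityMeasure π]

theorem measurePreserving_infinitePi_eval_fin (π : Measure Ω) [IsProbabilityMeasure π] (N : ℕ) :
    MeasurePreserving (fun (ω : ℕ → Ω) (i : Fin N) => ω i) (Measure.infinitePi fun _ => π)
      (Measure.pi fun _ => π) where
  measurable := by fun_prop
  map_eq := by
    rw [Measure.map_infinitePi_infinitePi_of_inj (P := fun _ : ℕ => π) Fin.val_injective,
      Measure.infinitePi_eq_pi]

theorem tendsto_integral_exp_sum {Z : Ω → ℝ} (hZ : Measurable Z) (hZ2 : MemLp Z 2 π)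
    (hZ0 : ∫ x, Z x ∂π = 0) :
    Tendsto (fun N : ℕ => ∫ ω, Complex.exp (((√N)⁻¹ * ∑ i, Z (ω i) : ℝ) * Complex.I)
      ∂Measure.pi fun _ : Fin N => π) atTop
      (𝓝 (Complex.exp (-((∫ x, Z x ^ 2 ∂π : ℝ) : ℂ) / 2))) := by
  have hmp (i : ℕ) := measurePreserving_eval_infinitePi (fun _ : ℕ => π) i
  have hident (i : ℕ) : IdentDistrib (fun ω : ℕ → Ω => Z (ω i)) Z
      (Measure.infinitePi fun _ => π) π :=
    { aemeasurable_fst := (hZ.comp (hmp i).measurable).aemeasurable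
      aemeasurable_snd := hZ.aemeasurable
      map_eq := by
        conv_rhs => rw [← (hmp i).map_eq, Measure.map_map hZ (hmp i).measurable]
        rfl }
  have hmean : ∫ ω : ℕ → Ω, Z (ω 0) ∂Measure.infinitePi (fun _ => π) = 0 :=
    (hident 0).integral_eq.trans hZ0
  have hclt := tendstoInDistribution_inv_sqrt_mul_sum_sub (P := Measure.infinitePi fun _ => π)
    (X := fun (i : ℕ) (ω : ℕ → Ω) => Z (ω i)) (Y := id) ⟨by fun_prop, Measure.map_id⟩
    (hZ2.comp_measurePreserving (hmp 0))
    (iIndepFun_infinitePi (P := fun _ : ℕ => π) (X := fun _ => Z) fun _ => hZ)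
    fun i => (hident i).trans (hident 0).symm
  have hchar := ProbabilityMeasure.tendsto_iff_tendsto_charFun.1 hclt.tendsto 1
  simp only [ProbabilityMeasure.coe_mk, Measure.map_id, hmean, mul_zero, sub_zero] at hchar
  rw [charFun_gaussianReal, (hident 0).variance_eq, variance_of_integral_eq_zero hZ.aemeasurable
    hZ0, Real.coe_toNNReal _ (integral_nonneg fun _ => sq_nonneg _)] at hchar
  convert hchar using 2 with N
  · rw [charFun_apply_real, integral_map (Measurable.aemeasurable (by fun_prop)) (by fun_prop),
      ← (measurePreserving_infinitePi_eval_fin π N).map_eq, integral_map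
      (Measurable.aemeasurable (by fun_prop)) (Measurable.aestronglyMeasurable (by fun_prop))]
    simp [Finset.sum_range]
  · congr 1
    simp only [Complex.ofReal_zero, Complex.ofReal_one]
    ring

theorem tendstoInDistribution_inv_sqrt_smul_sum {V : Type*} [NormedAddCommGroup V]
    [InnerProductSpace ℝ V] [FiniteDimensional ℝ V] [MeasurableSpace V] [BorelSpace V]
    {X : Ω → V} (hX : Measurable X) (hX2 : ∀ t, MemLp (fun x => inner ℝ (X x) t) 2 π)
    (hX0 : ∀ t, ∫ x, inner ℝ (X x) t ∂π = 0) {γ : Measure V} [IsProbabilityMeasure γ]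
    (hγ : ∀ t, charFun γ t = Complex.exp (-((∫ x, inner ℝ (X x) t ^ 2 ∂π : ℝ) : ℂ) / 2)) :
    TendstoInDistribution (fun (N : ℕ) (ω : Fin N → Ω) => (√N)⁻¹ • ∑ i, X (ω i)) atTop id
      (fun N => Measure.pi fun _ : Fin N => π) γ where
  forall_aemeasurable N := Measurable.aemeasurable (by fun_prop)
  tendsto := by
    refine ProbabilityMeasure.tendsto_iff_tendsto_charFun.2 fun t => ?_
    simp only [ProbabilityMeasure.coe_mk, Measure.map_id, hγ]
    refine (tendsto_integral_exp_sum (hX.inner_const) (hX2 t) (hX0 t)).congr fun N => ?_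
    rw [charFun_apply, integral_map (Measurable.aemeasurable (by fun_prop)) (by fun_prop)]
    simp only [inner_smul_left, sum_inner, conj_trivial]

end CentralLimit

section CanonicalSystem

variable {α β K : Type*} [MeasurableSpace α] [MeasurableSpace β]

/-- Canonical variables of a coupling `π`: two systems of functions which are centred and
orthonormal for the respective marginals, and whose cross-covariance under `π` is diagonal, with
the canonical correlations `s k` as entries. -/
structure IsCanonicalSystem [DecidableEq K] (π : Measure (α × β)) (s : K → ℝ) (φ : K → α → ℝ)
    (ψ : K → β → ℝ) : Prop where
  measurable_left : ∀ k, Measurable (φ k)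
  measurable_right : ∀ k, Measurable (ψ k)
  orthonormal_left : IsOrthonormalSystem π.fst φ
  orthonormal_right : IsOrthonormalSystem π.snd ψ
  integral_left : ∀ k, ∫ x, φ k x ∂π.fst = 0
  integral_right : ∀ k, ∫ y, ψ k y ∂π.snd = 0
  integral_mul : ∀ k l, ∫ p, φ k p.1 * ψ l p.2 ∂π = if k = l then s k else 0

/-- The pairs of normalized sums `N^{-1/2} ∑ φ_k(x_i)`, `N^{-1/2} ∑ ψ_k(y_i)` over two samples. -/
noncomputable def normalizedSums (φ : K → α → ℝ) (ψ : K → β → ℝ) (N : ℕ)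
    (z : (Fin N → α) × (Fin N → β)) : K → ℝ × ℝ :=
  (√N)⁻¹ • ∑ i, fun k => (φ k (z.1 i), ψ k (z.2 i))

theorem normalizedSums_comp_perm {α β : Type*} (φ : K → α → ℝ) (ψ : K → β → ℝ) {N : ℕ}
    (x : Fin N → α) (y : Fin N → β) (σ : Equiv.Perm (Fin N)) :
    normalizedSums φ ψ N (x, y ∘ σ) = normalizedSums φ ψ N (x, y) := by
  ext k
  · simp [normalizedSums, Prod.fst_sum]
  · simpa [normalizedSums, Prod.snd_sum] using .inl (Equiv.sum_comp σ fun i => ψ k (y i))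

section Euclidean

variable [Fintype K]

/-- A family of pairs of real numbers, read as a vector of a Euclidean space: characteristic
functions require an inner product. -/
noncomputable def pairsEquivEuclidean : (K → ℝ × ℝ) ≃L[ℝ] EuclideanSpace ℝ (K ⊕ K) :=
  LinearEquiv.toContinuousLinearEquiv
    { toFun x := WithLp.toLp 2 (Sum.elim (fun k => (x k).1) fun k => (x k).2)
      invFun v k := (v (.inl k), v (.inr k))
      map_add' x y := by ext (k | k) <;> simp
      map_smul' r x := by ext (k | k) <;> simp
      left_inv x := rfl
      right_inv v := by ext (k | k) <;> rfl }

theorem inner_pairsEquivEuclidean (x : K → ℝ × ℝ) (t : EuclideanSpace ℝ (K ⊕ K)) :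
    inner ℝ (pairsEquivEuclidean x) t =
      ∑ k, t (.inl k) * (x k).1 + ∑ k, t (.inr k) * (x k).2 := by
  simp only [PiLp.inner_apply, Fintype.sum_sum_type]
  rfl

theorem charFun_map_pairsEquivEuclidean {s : K → ℝ} (hs : ∀ k, s k ^ 2 < 1)
    (t : EuclideanSpace ℝ (K ⊕ K)) :
    charFun ((Measure.pi fun k => correlatedGaussian (s k)).map pairsEquivEuclidean) t =
      Complex.exp (-((∑ k, (t (.inl k) ^ 2 + 2 * s k * t (.inl k) * t (.inr k) +
        t (.inr k) ^ 2) : ℝ) : ℂ) / 2) := by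
  have hprod (x : K → ℝ × ℝ) :
      Complex.exp ((inner ℝ (pairsEquivEuclidean x) t : ℝ) * Complex.I) = ∏ k, Complex.exp
        ((t (.inl k) * (x k).1 + t (.inr k) * (x k).2 : ℝ) * Complex.I) := by
    rw [inner_pairsEquivEuclidean, ← Finset.sum_add_distrib, ← Complex.exp_sum,
      Complex.ofReal_sum, Finset.sum_mul]
  rw [charFun_apply, integral_map (by fun_prop) (by fun_prop)]
  simp_rw [hprod]
  rw [integral_fintype_prod_eq_prod fun k (p : ℝ × ℝ) => Complex.exp
    ((t (.inl k) * p.1 + t (.inr k) * p.2 : ℝ) * Complex.I)]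
  simp_rw [charFun_correlatedGaussian (hs _)]
  rw [← Complex.exp_sum, ← Finset.sum_div, Finset.sum_neg_distrib, Complex.ofReal_sum]

end Euclidean

namespace IsCanonicalSystem

variable [DecidableEq K] {π : Measure (α × β)} {s : K → ℝ} {φ : K → α → ℝ} {ψ : K → β → ℝ}

theorem comp_injective {J : Type*} [DecidableEq J] (h : IsCanonicalSystem π s φ ψ) {e : J → K}
    (he : Function.Injective e) :
    IsCanonicalSystem π (fun j => s (e j)) (fun j => φ (e j)) fun j => ψ (e j) where
  measurable_left j := h.measurable_left (e j)
  measurable_right j := h.measurable_right (e j)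
  orthonormal_left := h.orthonormal_left.comp_injective he
  orthonormal_right := h.orthonormal_right.comp_injective he
  integral_left j := h.integral_left (e j)
  integral_right j := h.integral_right (e j)
  integral_mul i j := by simp_rw [h.integral_mul, he.eq_iff]

theorem prod [IsProbabilityMeasure π] (h : IsCanonicalSystem π s φ ψ) :
    IsCanonicalSystem (π.fst.prod π.snd) (fun _ => 0) φ ψ where
  measurable_left := h.measurable_left
  measurable_right := h.measurable_right
  orthonormal_left := by simpa using h.orthonormal_left
  orthonormal_right := by simpa using h.orthonormal_right
  integral_left := by simpa using h.integral_left
  integral_right := by simpa using h.integral_right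
  integral_mul k l := by
    rw [integral_prod_mul (φ k) (ψ l), h.integral_left, zero_mul, ite_self]

theorem measurable_normalizedSums (h : IsCanonicalSystem π s φ ψ) (N : ℕ) :
    Measurable (normalizedSums φ ψ N) := by
  have := h.measurable_left
  have := h.measurable_right
  unfold normalizedSums
  fun_prop

theorem orthonormal_comp_fst (h : IsCanonicalSystem π s φ ψ) :
    IsOrthonormalSystem π fun k p => φ k p.1 :=
  h.orthonormal_left.comp_measurePreserving ⟨measurable_fst, rfl⟩

theorem orthonormal_comp_snd (h : IsCanonicalSystem π s φ ψ) :
    IsOrthonormalSystem π fun k p => ψ k p.2 :=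
  h.orthonormal_right.comp_measurePreserving ⟨measurable_snd, rfl⟩

variable [Fintype K]

theorem memLp_sum (h : IsCanonicalSystem π s φ ψ) (a b : K → ℝ) :
    MemLp (fun p => ∑ k, a k * φ k p.1 + ∑ k, b k * ψ k p.2) 2 π :=
  (h.orthonormal_comp_fst.memLp_sum a).add (h.orthonormal_comp_snd.memLp_sum b)

theorem integral_sum [IsProbabilityMeasure π] (h : IsCanonicalSystem π s φ ψ) (a b : K → ℝ) :
    ∫ p, (∑ k, a k * φ k p.1 + ∑ k, b k * ψ k p.2) ∂π = 0 := by
  have hφ0 (k : K) : ∫ p : α × β, φ k p.1 ∂π = 0 :=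
    (integral_comp_measurePreserving ⟨measurable_fst, rfl⟩ (h.orthonormal_left.memLp k).1).trans
      (h.integral_left k)
  have hψ0 (k : K) : ∫ p : α × β, ψ k p.2 ∂π = 0 :=
    (integral_comp_measurePreserving ⟨measurable_snd, rfl⟩ (h.orthonormal_right.memLp k).1).trans
      (h.integral_right k)
  rw [integral_add ((h.orthonormal_comp_fst.memLp_sum a).integrable one_le_two)
      ((h.orthonormal_comp_snd.memLp_sum b).integrable one_le_two),
    integral_finsetSum _ fun k _ =>
      ((h.orthonormal_comp_fst.memLp k).integrable one_le_two).const_mul _,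
    integral_finsetSum _ fun k _ =>
      ((h.orthonormal_comp_snd.memLp k).integrable one_le_two).const_mul _]
  simp_rw [integral_const_mul, hφ0, hψ0, mul_zero, Finset.sum_const_zero, add_zero]

theorem integral_sum_sq (h : IsCanonicalSystem π s φ ψ) (a b : K → ℝ) :
    ∫ p, (∑ k, a k * φ k p.1 + ∑ k, b k * ψ k p.2) ^ 2 ∂π =
      ∑ k, (a k ^ 2 + 2 * s k * a k * b k + b k ^ 2) := by
  have hφ := (h.orthonormal_comp_fst.memLp_sum a).integrable_sq
  have hψ := (h.orthonormal_comp_snd.memLp_sum b).integrable_sq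
  have hφψ (k l : K) : Integrable (fun p => φ k p.1 * ψ l p.2) π :=
    (h.orthonormal_comp_fst.memLp k).integrable_mul (h.orthonormal_comp_snd.memLp l)
  have hcross := (integrable_sum_mul_sum hφψ a b).const_mul 2
  have hφcross : Integrable (fun p => (∑ k, a k * φ k p.1) ^ 2 +
      2 * ((∑ k, a k * φ k p.1) * ∑ k, b k * ψ k p.2)) π := hφ.add hcross
  simp_rw [add_sq, mul_assoc (2 : ℝ) (∑ _, _)]
  rw [integral_add hφcross hψ, integral_add hφ hcross, integral_const_mul,
    h.orthonormal_comp_fst.integral_sum_sq, h.orthonormal_comp_snd.integral_sum_sq,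
    integral_sum_mul_sum_of_orthogonal hφψ h.integral_mul, Finset.mul_sum,
    ← Finset.sum_add_distrib, ← Finset.sum_add_distrib]
  exact Finset.sum_congr rfl fun k _ => by ring

theorem map_normalizedSums_sampleLaw (h : IsCanonicalSystem π s φ ψ) (N : ℕ) :
    (sampleLaw π N).map (normalizedSums φ ψ N) =
      (Measure.pi fun _ => π).map (pairsEquivEuclidean.symm ∘ fun ω : Fin N → α × β =>
        (√N)⁻¹ • ∑ i, pairsEquivEuclidean fun k => (φ k (ω i).1, ψ k (ω i).2)) := by
  rw [sampleLaw, Measure.map_map (h.measurable_normalizedSums N) (MeasurableEquiv.measurable _)]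
  congr 1
  ext1 ω
  rw [Function.comp_apply, Function.comp_apply, map_smul, map_sum]
  rfl

theorem tendstoInDistribution_normalizedSums [IsProbabilityMeasure π]
    (h : IsCanonicalSystem π s φ ψ) (hs : ∀ k, s k ^ 2 < 1) :
    TendstoInDistribution (normalizedSums φ ψ) atTop id (fun N => sampleLaw π N)
      (Measure.pi fun k => correlatedGaussian (s k)) := by
  let X (p : α × β) : EuclideanSpace ℝ (K ⊕ K) :=
    pairsEquivEuclidean fun k => (φ k p.1, ψ k p.2)
  have hX : Measurable X := by
    have := h.measurable_left
    have := h.measurable_right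
    exact pairsEquivEuclidean.continuous.measurable.comp (by fun_prop)
  have hinner (t : EuclideanSpace ℝ (K ⊕ K)) (p : α × β) : inner ℝ (X p) t =
      ∑ k, t (.inl k) * φ k p.1 + ∑ k, t (.inr k) * ψ k p.2 := inner_pairsEquivEuclidean _ t
  have := Measure.isProbabilityMeasure_map (μ := Measure.pi fun k => correlatedGaussian (s k))
    (f := pairsEquivEuclidean) (by fun_prop)
  have hclt := tendstoInDistribution_inv_sqrt_smul_sum hX
    (fun t => by simpa only [hinner] using h.memLp_sum _ _)
    (fun t => by simpa only [hinner] using h.integral_sum _ _)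
    (fun t => by simp_rw [hinner, h.integral_sum_sq]; exact charFun_map_pairsEquivEuclidean hs t)
  have hlim := hclt.continuous_comp pairsEquivEuclidean.symm.continuous
  have hlaw_lim : (Measure.pi fun k => correlatedGaussian (s k)).map id =
      ((Measure.pi fun k => correlatedGaussian (s k)).map pairsEquivEuclidean).map
        (pairsEquivEuclidean.symm ∘ id) := by
    rw [Measure.map_map (by fun_prop) (by fun_prop)]
    congr 1
  exact
    { forall_aemeasurable := fun N => (h.measurable_normalizedSums N).aemeasurable
      tendsto := by
        simpa only [h.map_normalizedSums_sampleLaw, hlaw_lim] using hlim.tendsto }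

end IsCanonicalSystem

end CanonicalSystem

section Eigenbasis

universe u

variable {H H' ι : Type*} [NormedAddCommGroup H] [InnerProductSpace ℝ H]
  [NormedAddCommGroup H'] [InnerProductSpace ℝ H']

theorem countable_of_orthonormal [TopologicalSpace.SeparableSpace H] {v : ι → H}
    (hv : Orthonormal ℝ v) : Countable ι := by
  refine Pairwise.countable_of_isOpen_disjoint (s := fun i => Metric.ball (v i) (1 / 2))
    (fun i j hij => Metric.ball_disjoint_ball ?_) (fun i => Metric.isOpen_ball)
    fun i => Metric.nonempty_ball.2 (by norm_num)
  have h : ‖v i - v j‖ ^ 2 = 2 := by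
    rw [norm_sub_sq_real, hv.1, hv.1, hv.inner_eq_zero hij]
    norm_num
  rw [dist_eq_norm]
  nlinarith [norm_nonneg (v i - v j)]

open Module.End in
theorem exists_hilbertBasis_eigenvectors {H : Type u} [NormedAddCommGroup H]
    [InnerProductSpace ℝ H] [CompleteSpace H] {T : H →L[ℝ] H} (hT : IsCompactOperator T)
    (hT' : (T : H →ₗ[ℝ] H).IsSymmetric) :
    ∃ (ι : Type u) (e : HilbertBasis ι ℝ H) (t : ι → ℝ), ∀ i, T (e i) = t i • e i := by
  let V (m : ℝ) : Submodule ℝ H := eigenspace (T : H →ₗ[ℝ] H) m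
  have hV (m : ℝ) : CompleteSpace (V m) := by
    have hclosed : IsClosed {x | T x = m • x} := isClosed_eq T.continuous (by fun_prop)
    have hcoe : (V m : Set H) = {x | T x = m • x} := Set.ext fun x => mem_eigenspace_iff
    exact (hcoe ▸ hclosed : IsClosed (V m : Set H)).completeSpace_coe
  choose v B _ using fun m : ℝ => exists_hilbertBasis ℝ (V m)
  let q : (Σ m, v m) → H := fun a => B a.1 a.2
  have hq : Orthonormal ℝ q :=
    hT'.orthogonalFamily_eigenspaces.orthonormal_sigma_orthonormal fun m => (B m).orthonormal
  have hspan : (Submodule.span ℝ (Set.range q))ᗮ = ⊥ := by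
    rw [eq_bot_iff, ← T.orthogonalComplement_iSup_eigenspaces_eq_bot hT hT',
      ← Submodule.iInf_orthogonal]
    refine fun x hx => (Submodule.mem_iInf _).2 fun m => (Submodule.mem_orthogonal' _ _).2
      fun z hz => ?_
    have hzero : (innerSL ℝ x).comp (V m).subtypeL = 0 := by
      refine ContinuousLinearMap.ext_on
        (Submodule.dense_iff_topologicalClosure_eq_top.2 (B m).dense_span) ?_
      rintro _ ⟨i, rfl⟩
      exact (Submodule.mem_orthogonal' _ _).1 hx _ (Submodule.subset_span ⟨⟨m, i⟩, rfl⟩)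
    exact DFunLike.congr_fun hzero ⟨z, hz⟩
  refine ⟨Σ m, v m, HilbertBasis.mkOfOrthogonalEqBot hq hspan, Sigma.fst, fun i => ?_⟩
  rw [HilbertBasis.coe_mkOfOrthogonalEqBot]
  exact mem_eigenspace_iff.1 (B i.1 i.2).2

theorem eigenvalue_eq_one_of_inner_ne_zero {T : H →L[ℝ] H} {u e : H} {t : ℝ}
    (hT : (T : H →ₗ[ℝ] H).IsSymmetric) (hgap : HasEigenvalueGap T u) (hu : ‖u‖ = 1)
    (hTu : T u = u) (he : ‖e‖ = 1) (hTe : T e = t • e) (hue : inner ℝ u e ≠ 0) :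
    t = 1 ∧ inner ℝ u e ^ 2 = 1 := by
  have ht : t = 1 := by
    have h := hT u e
    rw [ContinuousLinearMap.coe_coe, hTu, hTe, real_inner_smul_right] at h
    exact (mul_eq_right₀ hue).1 h.symm
  have hproj : e = inner ℝ u e • u := by
    obtain ⟨r, hr, hgap⟩ := hgap
    by_contra h
    refine hr.not_ge (hgap 1 (e - inner ℝ u e • u) (sub_ne_zero.2 h) ?_ ?_)
    · rw [inner_sub_right, real_inner_smul_right, real_inner_self_eq_norm_sq, hu]
      ring
    · rw [map_sub, map_smul, hTu, hTe, ht, one_smul, one_smul]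
  refine ⟨ht, ?_⟩
  have hnorm := congrArg norm hproj
  rw [norm_smul, he, hu, mul_one, Real.norm_eq_abs] at hnorm
  rw [← sq_abs, ← hnorm, one_pow]

/-- `e`, `e'` and `s` form a singular value decomposition of `A`, apart from a leading pair of
singular vectors `u`, `A u` of singular value `1`, to which the other ones are orthogonal. -/
structure IsSingularSystem [DecidableEq ι] (A : H →L[ℝ] H') (u : H) (e : ι → H) (e' : ι → H')
    (s : ι → ℝ) : Prop where
  orthonormal_left : Orthonormal ℝ e
  orthonormal_right : Orthonormal ℝ e'
  inner_left : ∀ i, inner ℝ u (e i) = 0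
  inner_right : ∀ i, inner ℝ (A u) (e' i) = 0
  inner_apply : ∀ i j, inner ℝ (A (e i)) (e' j) = if i = j then s i else 0

variable [CompleteSpace H] [CompleteSpace H'] {A : H →L[ℝ] H'}

theorem inner_apply_of_adjoint_comp_self_eigenvectors [DecidableEq ι] {e : ι → H} {t : ι → ℝ}
    (he : Orthonormal ℝ e) (ht : ∀ i, (A.adjoint ∘L A) (e i) = t i • e i) (i j : ι) :
    inner ℝ (A (e i)) (A (e j)) = if i = j then t i else 0 := by
  rw [← ContinuousLinearMap.adjoint_inner_left, ← ContinuousLinearMap.comp_apply, ht,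
    real_inner_smul_left, orthonormal_iff_ite.1 he, mul_ite, mul_one, mul_zero]

theorem isSingularSystem_of_adjoint_comp_self_eigenvectors [DecidableEq ι] {u : H} {e : ι → H}
    {t : ι → ℝ} (hu : (A.adjoint ∘L A) u = u) (he : Orthonormal ℝ e)
    (hue : ∀ i, inner ℝ u (e i) = 0)
    (ht : ∀ i, (A.adjoint ∘L A) (e i) = t i • e i) (htpos : ∀ i, 0 < t i) :
    IsSingularSystem A u e (fun i => (√(t i))⁻¹ • A (e i)) fun i => √(t i) where
  orthonormal_left := he
  orthonormal_right := by
    rw [orthonormal_iff_ite]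
    intro i j
    rw [real_inner_smul_left, real_inner_smul_right,
      inner_apply_of_adjoint_comp_self_eigenvectors he ht]
    split_ifs with h
    · rw [← h, ← mul_assoc, ← mul_inv, Real.mul_self_sqrt (htpos i).le,
        inv_mul_cancel₀ (htpos i).ne']
    · rw [mul_zero, mul_zero]
  inner_left := hue
  inner_right i := by
    rw [real_inner_smul_right, ← ContinuousLinearMap.adjoint_inner_left,
      ← ContinuousLinearMap.comp_apply, hu, hue, mul_zero]
  inner_apply i j := by
    rw [real_inner_smul_right, inner_apply_of_adjoint_comp_self_eigenvectors he ht]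
    split_ifs with h
    · rw [← h, inv_mul_eq_div, Real.div_sqrt]
    · rw [mul_zero]

open Classical in
theorem exists_isSingularSystem {H : Type u} [NormedAddCommGroup H] [InnerProductSpace ℝ H]
    [CompleteSpace H] {A : H →L[ℝ] H'} {u : H} {S : ℝ} (hA : IsCompactOperator A)
    (hgap : HasEigenvalueGap (A.adjoint ∘L A) u) (hu : ‖u‖ = 1) (hAu : (A.adjoint ∘L A) u = u)
    (hS : ∀ (ι : Type u) (e : HilbertBasis ι ℝ H), HasSum (fun i => ‖A (e i)‖ ^ 2) S) :
    ∃ (ι : Type u) (_ : DecidableEq ι) (e : ι → H) (e' : ι → H') (s : ι → ℝ) (r : ℝ),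
      IsSingularSystem A u e e' s ∧ r < 1 ∧ (∀ i, s i ^ 2 ≤ r) ∧
        HasSum (fun i => s i ^ 2) (S - 1) := by
  have hsymm : (A.adjoint ∘L A : H →L[ℝ] H).toLinearMap.IsSymmetric :=
    A.isPositive_adjoint_comp_self.isSymmetric
  obtain ⟨ι, e, t, ht⟩ := exists_hilbertBasis_eigenvectors (hA.clm_comp A.adjoint) hsymm
  have hnorm (i : ι) : ‖A (e i)‖ ^ 2 = t i := by
    rw [← real_inner_self_eq_norm_sq,
      inner_apply_of_adjoint_comp_self_eigenvectors e.orthonormal ht, if_pos rfl]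
  have hsum : HasSum (fun i => t i - inner ℝ u (e i) ^ 2) (S - 1) := by
    have h := (hS ι e).sub (e.hasSum_inner_mul_inner u u)
    simp only [hnorm, real_inner_self_eq_norm_sq, hu, one_pow] at h
    simpa only [real_inner_comm u, ← sq] using h
  let J : Set ι := {i | inner ℝ u (e i) = 0 ∧ 0 < t i}
  have hterm (i : ι) : t i - inner ℝ u (e i) ^ 2 = J.indicator t i := by
    by_cases hue : inner ℝ u (e i) = 0
    · have htpos : 0 ≤ t i := hnorm i ▸ sq_nonneg _
      by_cases hti : 0 < t i
      · rw [Set.indicator_of_mem (show i ∈ J from ⟨hue, hti⟩), hue]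
        ring
      · rw [Set.indicator_of_notMem fun h : i ∈ J => hti h.2, hue, htpos.antisymm' (not_lt.1 hti)]
        ring
    · obtain ⟨hti, hsq⟩ := eigenvalue_eq_one_of_inner_ne_zero hsymm hgap hu hAu
        (e.orthonormal.1 i) (ht i) hue
      rw [Set.indicator_of_notMem fun h : i ∈ J => hue h.1, hti, hsq, sub_self]
  have hsq (i : J) : √(t i) ^ 2 = t i := Real.sq_sqrt i.2.2.le
  have hsys := isSingularSystem_of_adjoint_comp_self_eigenvectors hAu
    (e.orthonormal.comp _ Subtype.val_injective) (fun i : J => i.2.1) (fun i => ht i)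
    fun i => i.2.2
  obtain ⟨r, hr, hgap⟩ := hgap
  refine ⟨J, _, _, _, _, r, hsys, hr, fun i => ?_, ?_⟩
  · rw [hsq]
    exact hgap _ _ (e.orthonormal.ne_zero i) i.2.1 (ht i)
  · simp_rw [hsq]
    simp_rw [hterm] at hsum
    exact (hasSum_subtype_iff_indicator (s := J)).2 hsum

end Eigenbasis

section KernelOperators

variable {α β : Type*} [MeasurableSpace α] [MeasurableSpace β] {μ : Measure α} {ν : Measure β}

theorem memLp_two_mul_prod {f : α → ℝ} {g : β → ℝ} (hf : MemLp f 2 μ)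
    (hg : MemLp g 2 ν) : MemLp (fun z : α × β => f z.1 * g z.2) 2 (μ.prod ν) := by
  refine (memLp_two_iff_integrable_sq (hf.1.comp_fst.mul hg.1.comp_snd)).2 ?_
  simpa only [Pi.mul_apply, mul_pow] using hf.integrable_sq.mul_prod hg.integrable_sq

theorem inner_Lp_eq_integral (f g : Lp ℝ 2 μ) : inner ℝ f g = ∫ x, f x * g x ∂μ := by
  simp only [L2.inner_def, RCLike.inner_apply, conj_trivial, mul_comm]

theorem inner_toLp_eq_integral {f g : α → ℝ} (hf : MemLp f 2 μ) (hg : MemLp g 2 μ) :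
    inner ℝ (hf.toLp f) (hg.toLp g) = ∫ x, f x * g x ∂μ := by
  rw [inner_Lp_eq_integral]
  refine integral_congr_ae ?_
  filter_upwards [hf.coeFn_toLp, hg.coeFn_toLp] with x hfx hgx
  rw [hfx, hgx]

theorem inner_const_Lp [IsFiniteMeasure μ] (f : Lp ℝ 2 μ) :
    inner ℝ (Lp.const 2 μ 1) f = ∫ x, f x ∂μ := by
  rw [inner_Lp_eq_integral]
  refine integral_congr_ae ?_
  filter_upwards [Lp.coeFn_const 2 μ (1 : ℝ)] with x hx
  rw [hx, Function.const_apply, one_mul]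

theorem ofReal_norm_sq_eq_lintegral (f : Lp ℝ 2 μ) :
    ENNReal.ofReal (‖f‖ ^ 2) = ∫⁻ x, ENNReal.ofReal (f x ^ 2) ∂μ := by
  rw [← real_inner_self_eq_norm_sq, inner_Lp_eq_integral]
  simp only [← sq]
  exact ofReal_integral_eq_lintegral_ofReal (Lp.memLp f).integrable_sq
    (.of_forall fun _ => sq_nonneg _)

variable [IsProbabilityMeasure μ] [IsProbabilityMeasure ν] {k : α × β → ℝ}

theorem integral_mul_kernel (hk : MemLp k 2 (μ.prod ν)) (f : Lp ℝ 2 μ) (g : Lp ℝ 2 ν) :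
    ∫ z, f z.1 * g z.2 * k z ∂μ.prod ν = inner ℝ (kernelOperator k hk f) g := by
  have hint : Integrable (fun z : α × β => f z.1 * g z.2 * k z) (μ.prod ν) :=
    (memLp_two_mul_prod (Lp.memLp f) (Lp.memLp g)).integrable_mul hk
  rw [inner_Lp_eq_integral, integral_prod_symm _ hint]
  refine integral_congr_ae ?_
  filter_upwards [kernelOperator_ae_eq k hk f] with y hy
  rw [hy, ← integral_mul_const]
  simp only [mul_right_comm]

theorem ae_memLp_kernel_section (hk : MemLp k 2 (μ.prod ν)) :
    ∀ᵐ y ∂ν, MemLp (fun x => k (x, y)) 2 μ := by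
  have hswap : AEStronglyMeasurable (fun z : β × α => k z.swap) (ν.prod μ) := hk.1.prod_swap
  filter_upwards [hswap.prodMk_left, hk.integrable_sq.prod_left_ae] with y hmeas hint
  exact (memLp_two_iff_integrable_sq hmeas).2 hint

theorem ae_hasSum_kernelOperator_sq {ι : Type*} [Countable ι] (e : HilbertBasis ι ℝ (Lp ℝ 2 μ))
    (hk : MemLp k 2 (μ.prod ν)) :
    ∀ᵐ y ∂ν, HasSum (fun i => kernelOperator k hk (e i) y ^ 2) (∫ x, k (x, y) ^ 2 ∂μ) := by
  filter_upwards [ae_memLp_kernel_section hk,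
    ae_all_iff.2 fun i => kernelOperator_ae_eq k hk (e i)] with y hy hval
  have hcoeff (i : ι) : inner ℝ (e i) (hy.toLp _) = kernelOperator k hk (e i) y := by
    rw [hval]
    nth_rw 1 [← Lp.toLp_coeFn (e i) (Lp.memLp _)]
    exact inner_toLp_eq_integral _ hy
  have hparseval := e.hasSum_inner_mul_inner (hy.toLp _) (hy.toLp _)
  simpa only [real_inner_comm (e _), hcoeff, inner_toLp_eq_integral, ← sq] using hparseval

theorem hasSum_of_tsum_ofReal_eq {ι : Type*} {f : ι → ℝ} {a : ℝ} (hf : ∀ i, 0 ≤ f i) (ha : 0 ≤ a)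
    (h : ∑' i, ENNReal.ofReal (f i) = ENNReal.ofReal a) : HasSum f a := by
  have hsum := ENNReal.hasSum_toReal (h.trans_ne ENNReal.ofReal_ne_top)
  rw [← ENNReal.tsum_toReal_eq fun _ => ENNReal.ofReal_ne_top, h, ENNReal.toReal_ofReal ha] at hsum
  simpa only [ENNReal.toReal_ofReal (hf _)] using hsum

theorem hasSum_norm_kernelOperator_sq {ι : Type*} [Countable ι] (e : HilbertBasis ι ℝ (Lp ℝ 2 μ))
    (hk : MemLp k 2 (μ.prod ν)) :
    HasSum (fun i => ‖kernelOperator k hk (e i)‖ ^ 2) (∫ z, k z ^ 2 ∂μ.prod ν) := by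
  have hsection : ∀ᵐ y ∂ν, ∑' i, ENNReal.ofReal (kernelOperator k hk (e i) y ^ 2) =
      ∫⁻ x, ENNReal.ofReal (k (x, y) ^ 2) ∂μ := by
    filter_upwards [ae_hasSum_kernelOperator_sq e hk, ae_memLp_kernel_section hk] with y hsum hy
    rw [← ENNReal.ofReal_tsum_of_nonneg (fun _ => sq_nonneg _) hsum.summable, hsum.tsum_eq,
      ofReal_integral_eq_lintegral_ofReal hy.integrable_sq (.of_forall fun _ => sq_nonneg _)]
  refine hasSum_of_tsum_ofReal_eq (fun _ => sq_nonneg _) (integral_nonneg fun _ => sq_nonneg _) ?_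
  calc ∑' i, ENNReal.ofReal (‖kernelOperator k hk (e i)‖ ^ 2)
      = ∫⁻ y, ∑' i, ENNReal.ofReal (kernelOperator k hk (e i) y ^ 2) ∂ν := by
        simp_rw [ofReal_norm_sq_eq_lintegral]
        exact (lintegral_tsum fun i =>
          ((Lp.aestronglyMeasurable _).aemeasurable.pow_const 2).ennreal_ofReal).symm
    _ = ∫⁻ z, ENNReal.ofReal (k z ^ 2) ∂μ.prod ν := by
        rw [lintegral_congr_ae hsection,
          lintegral_prod_symm _ (hk.1.aemeasurable.pow_const 2).ennreal_ofReal]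
    _ = ENNReal.ofReal (∫ z, k z ^ 2 ∂μ.prod ν) :=
        (ofReal_integral_eq_lintegral_ofReal hk.integrable_sq
          (.of_forall fun _ => sq_nonneg _)).symm

end KernelOperators

section SquareIntegrableDensity

universe u

variable {α : Type u} {β : Type*} [MeasurableSpace α] [MeasurableSpace β] {π : Measure (α × β)}
  {k : α × β → ℝ}

/-- `k` is a square integrable density of `π` with respect to the product of the two marginals
of `π`. -/
structure IsSquareIntegrableDensity (π : Measure (α × β)) (k : α × β → ℝ) : Prop where
  measurable : Measurable k
  nonneg : ∀ z, 0 ≤ k z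
  memLp : MemLp k 2 (π.fst.prod π.snd)
  eq_withDensity : π = (π.fst.prod π.snd).withDensity fun z => ENNReal.ofReal (k z)

/-- The expansion `k = 1 + ∑ i, s i • φ i ⊗ ψ i` of the density `k` of `π`, with correlations `s i`
bounded away from `±1`. That the series sums to `k` is encoded by Parseval's identity. -/
structure IsCanonicalExpansion {ι : Type*} [DecidableEq ι] (π : Measure (α × β)) (k : α × β → ℝ)
    (s : ι → ℝ) (φ : ι → α → ℝ) (ψ : ι → β → ℝ) : Prop
    extends IsCanonicalSystem π s φ ψ where
  exists_sq_le : ∃ r < 1, ∀ i, s i ^ 2 ≤ r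
  hasSum_sq : HasSum (fun i => s i ^ 2) (∫ z, k z ^ 2 ∂π.fst.prod π.snd - 1)

namespace IsSquareIntegrableDensity

theorem integral_eq (h : IsSquareIntegrableDensity π k) (f : α × β → ℝ) :
    ∫ z, f z ∂π = ∫ z, f z * k z ∂π.fst.prod π.snd := by
  have hk := h.measurable
  nth_rw 1 [h.eq_withDensity]
  rw [integral_withDensity_eq_integral_toReal_smul (by fun_prop)
    (.of_forall fun _ => ENNReal.ofReal_lt_top)]
  simp only [ENNReal.toReal_ofReal (h.nonneg _), smul_eq_mul, mul_comm]

variable [IsProbabilityMeasure π]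

theorem integral_mul (h : IsSquareIntegrableDensity π k) (f : Lp ℝ 2 π.fst) (g : Lp ℝ 2 π.snd) :
    ∫ z, f z.1 * g z.2 ∂π = inner ℝ (kernelOperator k h.memLp f) g := by
  rw [h.integral_eq, integral_mul_kernel]

theorem kernelOperator_const (h : IsSquareIntegrableDensity π k) :
    kernelOperator k h.memLp (Lp.const 2 π.fst 1) = Lp.const 2 π.snd 1 := by
  refine ext_inner_right ℝ fun g => ?_
  have hone : ∀ᵐ z ∂π, Lp.const 2 π.fst (1 : ℝ) z.1 = 1 :=
    ae_of_ae_map measurable_fst.aemeasurable (Lp.coeFn_const 2 π.fst (1 : ℝ))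
  rw [← h.integral_mul, inner_const_Lp]
  calc ∫ z, Lp.const 2 π.fst (1 : ℝ) z.1 * g z.2 ∂π
      = ∫ z, g z.2 ∂π := integral_congr_ae (hone.mono fun z hz => by simp only [hz, one_mul])
    _ = ∫ y, g y ∂π.snd := integral_comp_measurePreserving ⟨measurable_snd, rfl⟩ (Lp.memLp g).1

theorem adjoint_kernelOperator_const (h : IsSquareIntegrableDensity π k) :
    (kernelOperator k h.memLp).adjoint (Lp.const 2 π.snd 1) = Lp.const 2 π.fst 1 := by
  refine ext_inner_left ℝ fun f => ?_
  have hone : ∀ᵐ z ∂π, Lp.const 2 π.snd (1 : ℝ) z.2 = 1 :=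
    ae_of_ae_map measurable_snd.aemeasurable (Lp.coeFn_const 2 π.snd (1 : ℝ))
  rw [ContinuousLinearMap.adjoint_inner_right, ← h.integral_mul, real_inner_comm, inner_const_Lp]
  calc ∫ z, f z.1 * Lp.const 2 π.snd (1 : ℝ) z.2 ∂π
      = ∫ z, f z.1 ∂π := integral_congr_ae (hone.mono fun z hz => by simp only [hz, mul_one])
    _ = ∫ x, f x ∂π.fst := integral_comp_measurePreserving ⟨measurable_fst, rfl⟩ (Lp.memLp f).1

theorem isCanonicalSystem_of_isSingularSystem {ι : Type*} [DecidableEq ι]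
    (h : IsSquareIntegrableDensity π k) {e : ι → Lp ℝ 2 π.fst} {e' : ι → Lp ℝ 2 π.snd} {s : ι → ℝ}
    (he : IsSingularSystem (kernelOperator k h.memLp) (Lp.const 2 π.fst 1) e e' s) :
    IsCanonicalSystem π s (fun i => e i) fun i => e' i where
  measurable_left i := (Lp.stronglyMeasurable _).measurable
  measurable_right i := (Lp.stronglyMeasurable _).measurable
  orthonormal_left.memLp i := Lp.memLp _
  orthonormal_left.integral_mul i j := by
    rw [← inner_Lp_eq_integral, orthonormal_iff_ite.1 he.orthonormal_left]
  orthonormal_right.memLp i := Lp.memLp _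
  orthonormal_right.integral_mul i j := by
    rw [← inner_Lp_eq_integral, orthonormal_iff_ite.1 he.orthonormal_right]
  integral_left i := by rw [← inner_const_Lp, he.inner_left]
  integral_right i := by rw [← inner_const_Lp, ← h.kernelOperator_const, he.inner_right]
  integral_mul i j := by rw [h.integral_mul, he.inner_apply]

theorem exists_isCanonicalExpansion [MeasurableSpace.CountablyGenerated α]
    (h : IsSquareIntegrableDensity π k) (hcompact : IsCompactOperator (kernelOperator k h.memLp))
    (hgap : HasEigenvalueGap ((kernelOperator k h.memLp).adjoint ∘L kernelOperator k h.memLp)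
      (Lp.const 2 π.fst (1 : ℝ))) :
    ∃ (ι : Type u) (_ : Countable ι) (_ : DecidableEq ι) (s : ι → ℝ) (φ : ι → α → ℝ)
      (ψ : ι → β → ℝ), IsCanonicalExpansion π k s φ ψ := by
  have : Fact ((2 : ℝ≥0∞) ≠ ∞) := ⟨ENNReal.ofNat_ne_top⟩
  have hnorm : ‖Lp.const 2 π.fst (1 : ℝ)‖ = 1 := by
    simp [Lp.norm_const (p := 2) (μ := π.fst) (c := (1 : ℝ)) two_ne_zero]
  have hfixed : ((kernelOperator k h.memLp).adjoint ∘L kernelOperator k h.memLp)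
      (Lp.const 2 π.fst 1) = Lp.const 2 π.fst 1 := by
    rw [ContinuousLinearMap.comp_apply, h.kernelOperator_const, h.adjoint_kernelOperator_const]
  obtain ⟨ι, _, e, e', s, r, hsys, hr, hs, hsum⟩ := exists_isSingularSystem hcompact hgap hnorm
    hfixed fun ι e =>
      have := countable_of_orthonormal e.orthonormal
      hasSum_norm_kernelOperator_sq e h.memLp
  exact ⟨ι, countable_of_orthonormal hsys.orthonormal_left, inferInstance, s, _, _,
    { toIsCanonicalSystem := h.isCanonicalSystem_of_isSingularSystem hsys
      exists_sq_le := ⟨r, hr, hs⟩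
      hasSum_sq := hsum }⟩

end IsSquareIntegrableDensity

end SquareIntegrableDensity

section SecondMomentBound

variable {α β ι : Type*}

/-- The partial sum `1 + ∑ i ∈ F, s i • φ i ⊗ ψ i` of a canonical expansion. -/
noncomputable def truncatedKernel (s : ι → ℝ) (φ : ι → α → ℝ) (ψ : ι → β → ℝ) (F : Finset ι) :
    α × β → ℝ :=
  finiteRankKernel (fun i : F => s i) (fun i : F => φ i) fun i : F => ψ i

theorem tendsto_pairingAverage {κ : ℕ → α × β → ℝ} {k : α × β → ℝ} {N : ℕ}
    {z : (Fin N → α) × (Fin N → β)}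
    (h : ∀ i j, Tendsto (fun n => κ n (z.1 i, z.2 j)) atTop (𝓝 (k (z.1 i, z.2 j)))) :
    Tendsto (fun n => pairingAverage (κ n) N z) atTop (𝓝 (pairingAverage k N z)) :=
  tendsto_const_nhds.mul (tendsto_finsetSum _ fun σ _ => tendsto_finsetProd _ fun i _ => h i (σ i))

variable [MeasurableSpace α] [MeasurableSpace β]

theorem ae_tendsto_pairingAverage {μ : Measure α} {ν : Measure β} [IsProbabilityMeasure μ]
    [IsProbabilityMeasure ν] {κ : ℕ → α × β → ℝ} {k : α × β → ℝ}
    (h : ∀ᵐ z ∂μ.prod ν, Tendsto (fun n => κ n z) atTop (𝓝 (k z))) (N : ℕ) :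
    ∀ᵐ z ∂indepSampleLaw μ ν N,
      Tendsto (fun n => pairingAverage (κ n) N z) atTop (𝓝 (pairingAverage k N z)) := by
  have hpair (i j : Fin N) : MeasurePreserving
      (fun z : (Fin N → α) × (Fin N → β) => (z.1 i, z.2 j)) (indepSampleLaw μ ν N) (μ.prod ν) :=
    (measurePreserving_eval (fun _ : Fin N => μ) i).prod
      (measurePreserving_eval (fun _ : Fin N => ν) j)
  have hall := ae_all_iff.2 fun i => ae_all_iff.2 fun j =>
    (hpair i j).quasiMeasurePreserving.ae h
  exact hall.mono fun z hz => tendsto_pairingAverage hz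

theorem memLp_two_and_integral_sq_le_of_ae_tendsto {μ : Measure α} {f : ℕ → α → ℝ} {g : α → ℝ}
    {C : ℝ} (hf : ∀ n, MemLp (f n) 2 μ) (hC : ∀ n, ∫ x, f n x ^ 2 ∂μ ≤ C)
    (hlim : ∀ᵐ x ∂μ, Tendsto (fun n => f n x) atTop (𝓝 (g x))) :
    MemLp g 2 μ ∧ ∫ x, g x ^ 2 ∂μ ≤ C := by
  have hg : AEStronglyMeasurable g μ :=
    aestronglyMeasurable_of_tendsto_ae atTop (fun n => (hf n).1) hlim
  have hC0 : 0 ≤ C := (integral_nonneg fun _ => sq_nonneg _).trans (hC 0)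
  have hbound (n : ℕ) : ∫⁻ x, ENNReal.ofReal (f n x ^ 2) ∂μ ≤ ENNReal.ofReal C := by
    rw [← ofReal_integral_eq_lintegral_ofReal (hf n).integrable_sq
      (.of_forall fun _ => sq_nonneg _)]
    exact ENNReal.ofReal_le_ofReal (hC n)
  have hle : ∫⁻ x, ENNReal.ofReal (g x ^ 2) ∂μ ≤ ENNReal.ofReal C := by
    calc ∫⁻ x, ENNReal.ofReal (g x ^ 2) ∂μ
        = ∫⁻ x, liminf (fun n => ENNReal.ofReal (f n x ^ 2)) atTop ∂μ :=
          lintegral_congr_ae (hlim.mono fun x hx =>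
            ((ENNReal.continuous_ofReal.tendsto _).comp (hx.pow 2)).liminf_eq.symm)
      _ ≤ liminf (fun n => ∫⁻ x, ENNReal.ofReal (f n x ^ 2) ∂μ) atTop :=
          lintegral_liminf_le' fun n => ((hf n).1.aemeasurable.pow_const 2).ennreal_ofReal
      _ ≤ liminf (fun _ : ℕ => ENNReal.ofReal C) atTop :=
          liminf_le_liminf (.of_forall hbound)
      _ = ENNReal.ofReal C := liminf_const _
  constructor
  · refine (memLp_two_iff_integrable_sq hg).2
      ((lintegral_ofReal_ne_top_iff_integrable (hg.pow 2) (.of_forall fun _ => sq_nonneg _)).1 ?_)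
    exact (hle.trans_lt ENNReal.ofReal_lt_top).ne
  · rw [integral_eq_lintegral_of_nonneg_ae (.of_forall fun _ => sq_nonneg _) (hg.pow 2)]
    exact ENNReal.toReal_le_of_le_ofReal hC0 hle

theorem IsCanonicalSystem.isOrthonormalSystem_tensor {K : Type*} [DecidableEq K]
    {π : Measure (α × β)} [IsProbabilityMeasure π] {s : K → ℝ} {φ : K → α → ℝ} {ψ : K → β → ℝ}
    (h : IsCanonicalSystem π s φ ψ) :
    IsOrthonormalSystem (π.fst.prod π.snd) fun (j : Option K) z =>
      j.elim 1 φ z.1 * j.elim 1 ψ z.2 :=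
  ((h.orthonormal_left.option_elim_one h.integral_left).prod
    (h.orthonormal_right.option_elim_one h.integral_right)).comp_injective
      (e := fun j => (j, j)) fun _ _ hij => congrArg Prod.fst hij

namespace IsCanonicalExpansion

variable {π : Measure (α × β)} {k : α × β → ℝ} [DecidableEq ι] {s : ι → ℝ} {φ : ι → α → ℝ}
  {ψ : ι → β → ℝ}

theorem sq_lt_one (h : IsCanonicalExpansion π k s φ ψ) (i : ι) : s i ^ 2 < 1 :=
  let ⟨_, hr, hs⟩ := h.exists_sq_le
  (hs i).trans_lt hr

theorem exists_sum_sq_div_le (h : IsCanonicalExpansion π k s φ ψ) :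
    ∃ D, ∀ F : Finset ι, ∑ i ∈ F, s i ^ 2 / (1 - s i ^ 2) ≤ D := by
  obtain ⟨r, hr, hs⟩ := h.exists_sq_le
  refine ⟨(∫ z, k z ^ 2 ∂π.fst.prod π.snd - 1) / (1 - r), fun F => ?_⟩
  calc ∑ i ∈ F, s i ^ 2 / (1 - s i ^ 2)
      ≤ ∑ i ∈ F, s i ^ 2 / (1 - r) := by
        gcongr with i
        exact hs i
    _ = (∑ i ∈ F, s i ^ 2) / (1 - r) := (Finset.sum_div _ _ _).symm
    _ ≤ (∫ z, k z ^ 2 ∂π.fst.prod π.snd - 1) / (1 - r) := by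
        gcongr
        exact sum_le_hasSum F (fun _ _ => sq_nonneg _) h.hasSum_sq

theorem bddAbove_range_prod_inv (h : IsCanonicalExpansion π k s φ ψ) :
    BddAbove (Set.range fun F : Finset ι => ∏ i ∈ F, (1 - s i ^ 2)⁻¹) := by
  obtain ⟨D, hD⟩ := h.exists_sum_sq_div_le
  refine ⟨Real.exp D, Set.forall_mem_range.2 fun F => ?_⟩
  calc ∏ i ∈ F, (1 - s i ^ 2)⁻¹
      ≤ ∏ i ∈ F, Real.exp (s i ^ 2 / (1 - s i ^ 2)) := by
        refine Finset.prod_le_prod (fun i _ => (inv_pos.2 (sub_pos.2 (h.sq_lt_one i))).le)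
          fun i _ => ?_
        have hpos : 0 < 1 - s i ^ 2 := sub_pos.2 (h.sq_lt_one i)
        have hinv : (1 - s i ^ 2)⁻¹ = s i ^ 2 / (1 - s i ^ 2) + 1 := by
          field_simp
          ring
        exact hinv.trans_le (Real.add_one_le_exp _)
    _ = Real.exp (∑ i ∈ F, s i ^ 2 / (1 - s i ^ 2)) := (Real.exp_sum _ _).symm
    _ ≤ Real.exp D := Real.exp_le_exp.2 (hD F)

variable [IsProbabilityMeasure π]

theorem memLp_truncatedKernel (h : IsCanonicalExpansion π k s φ ψ) (F : Finset ι) :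
    MemLp (truncatedKernel s φ ψ F) 2 (π.fst.prod π.snd) := by
  rw [truncatedKernel, finiteRankKernel_eq_sum_option]
  exact (h.comp_injective Subtype.val_injective).isOrthonormalSystem_tensor.memLp_sum _

theorem integral_sub_truncatedKernel_sq (h : IsCanonicalExpansion π k s φ ψ)
    (hk : IsSquareIntegrableDensity π k) (F : Finset ι) :
    ∫ z, (k z - truncatedKernel s φ ψ F z) ^ 2 ∂π.fst.prod π.snd =
      ∫ z, k z ^ 2 ∂π.fst.prod π.snd - 1 - ∑ i ∈ F, s i ^ 2 := by
  have horth := (h.comp_injective (Subtype.val_injective (p := (· ∈ F)))).isOrthonormalSystem_tensor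
  have hcoeff (j : Option F) : ∫ z, k z * (j.elim 1 (fun i : F => φ i) z.1 *
      j.elim 1 (fun i : F => ψ i) z.2) ∂π.fst.prod π.snd = j.elim 1 fun i => s i := by
    simp_rw [mul_comm (k _)]
    rw [← hk.integral_eq]
    cases j with
    | none => simp
    | some i => simp [h.integral_mul]
  rw [truncatedKernel, finiteRankKernel_eq_sum_option, horth.integral_sub_sum_sq hk.memLp hcoeff,
    Fintype.sum_option, ← Finset.sum_coe_sort F]
  simp only [Option.elim_none, Option.elim_some]
  ring

theorem exists_seq_ae_tendsto_truncatedKernel [Countable ι] (h : IsCanonicalExpansion π k s φ ψ)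
    (hk : IsSquareIntegrableDensity π k) :
    ∃ F : ℕ → Finset ι, ∀ᵐ z ∂π.fst.prod π.snd,
      Tendsto (fun n => truncatedKernel s φ ψ (F n) z) atTop (𝓝 (k z)) := by
  have hnorm (F : Finset ι) : eLpNorm (truncatedKernel s φ ψ F - k) 2 (π.fst.prod π.snd) =
      ENNReal.ofReal √(∫ z, k z ^ 2 ∂π.fst.prod π.snd - 1 - ∑ i ∈ F, s i ^ 2) := by
    rw [eLpNorm_sub_comm, ← h.integral_sub_truncatedKernel_sq hk,
      (hk.memLp.sub (h.memLp_truncatedKernel F)).eLpNorm_eq_integral_rpow_norm two_ne_zero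
        ENNReal.ofNat_ne_top]
    simp [Real.sqrt_eq_rpow]
  have hlim : Tendsto (fun F => eLpNorm (truncatedKernel s φ ψ F - k) 2 (π.fst.prod π.snd))
      atTop (𝓝 0) := by
    simp_rw [hnorm]
    have hcont : Continuous fun t : ℝ => ENNReal.ofReal √t :=
      ENNReal.continuous_ofReal.comp Real.continuous_sqrt
    have hrest : Tendsto (fun F => ∫ z, k z ^ 2 ∂π.fst.prod π.snd - 1 - ∑ i ∈ F, s i ^ 2)
        atTop (𝓝 0) := by
      rw [← sub_self (∫ z, k z ^ 2 ∂π.fst.prod π.snd - 1)]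
      exact h.hasSum_sq.const_sub _
    simpa [Function.comp_def] using (hcont.tendsto 0).comp hrest
  obtain ⟨F, -, hF⟩ := (tendstoInMeasure_of_tendsto_eLpNorm two_ne_zero
    (fun F => (h.memLp_truncatedKernel F).1) hk.memLp.1 hlim).exists_seq_tendsto_ae'
  exact ⟨F, hF⟩

theorem memLp_pairingAverage_and_integral_sq_le [Countable ι]
    (h : IsCanonicalExpansion π k s φ ψ) (hk : IsSquareIntegrableDensity π k) (N : ℕ) :
    MemLp (pairingAverage k N) 2 (indepSampleLaw π.fst π.snd N) ∧
      ∫ z, pairingAverage k N z ^ 2 ∂indepSampleLaw π.fst π.snd N ≤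
        ⨆ F : Finset ι, ∏ i ∈ F, (1 - s i ^ 2)⁻¹ := by
  obtain ⟨F, hF⟩ := h.exists_seq_ae_tendsto_truncatedKernel hk
  have hsys (n : ℕ) := h.toIsCanonicalSystem.comp_injective
    (Subtype.val_injective (p := (· ∈ F n)))
  refine memLp_two_and_integral_sq_le_of_ae_tendsto
    (f := fun n => pairingAverage (truncatedKernel s φ ψ (F n)) N) (fun n => ?_) (fun n => ?_)
    (ae_tendsto_pairingAverage hF N)
  · exact memLp_pairingAverage_finiteRankKernel (hsys n).orthonormal_left (hsys n).integral_left
      (hsys n).orthonormal_right (hsys n).integral_right N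
  · refine (integral_pairingAverage_finiteRankKernel_sq_le (hsys n).orthonormal_left
      (hsys n).integral_left (hsys n).orthonormal_right (hsys n).integral_right
      (fun i => h.sq_lt_one i) N).trans ?_
    rw [Finset.prod_coe_sort (F n) fun i => (1 - s i ^ 2)⁻¹]
    exact le_ciSup h.bddAbove_range_prod_inv (F n)

end IsCanonicalExpansion

end SecondMomentBound

section Distribution

variable {S : Type*} [TopologicalSpace S] [MeasurableSpace S] [OpensMeasurableSpace S]
  {Ω : ℕ → Type*} [∀ n, MeasurableSpace (Ω n)] {P : ∀ n, Measure (Ω n)}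
  [∀ n, IsProbabilityMeasure (P n)] {Q : Measure S} [IsProbabilityMeasure Q]
  {X : ∀ n, Ω n → S}

theorem tendsto_integral_of_tendstoInDistribution (hX : TendstoInDistribution X atTop id P Q)
    {g : S → ℝ} (hg : Continuous g) {C : ℝ} (hC : ∀ x, |g x| ≤ C) :
    Tendsto (fun n => ∫ ω, g (X n ω) ∂P n) atTop (𝓝 (∫ x, g x ∂Q)) := by
  have hlim := ProbabilityMeasure.tendsto_iff_forall_integral_tendsto.1 hX.tendsto
    (BoundedContinuousFunction.ofNormedAddCommGroup g hg C hC)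
  simpa [integral_map (hX.forall_aemeasurable _) hg.aestronglyMeasurable] using hlim

theorem eventually_measureReal_preimage_lt [HasOuterApproxClosed S]
    (hX : TendstoInDistribution X atTop id P Q) {C : Set S} (hC : IsClosed C) {a : ℝ}
    (ha : Q.real C < a) : ∀ᶠ n in atTop, (P n).real (X n ⁻¹' C) < a := by
  have hlt : limsup (fun n => (P n).map (X n) C) atTop < ENNReal.ofReal a := by
    refine (ProbabilityMeasure.limsup_measure_closed_le_of_tendsto hX.tendsto hC).trans_lt ?_
    rw [ProbabilityMeasure.coe_mk, Measure.map_id]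
    exact (ENNReal.lt_ofReal_iff_toReal_lt (measure_ne_top Q C)).2 ha
  filter_upwards [eventually_lt_of_limsup_lt hlt] with n hn
  rw [Measure.map_apply_of_aemeasurable (hX.forall_aemeasurable n) hC.measurableSet] at hn
  exact ENNReal.toReal_lt_of_lt_ofReal hn

end Distribution

section LowerBound

variable {Ω : Type*} [MeasurableSpace Ω] {P : Measure Ω} {f H L : Ω → ℝ}

theorem integral_sub_sq (hH : MemLp H 2 P) (hL : MemLp L 2 P) :
    ∫ ω, (H ω - L ω) ^ 2 ∂P =
      ∫ ω, H ω ^ 2 ∂P - 2 * ∫ ω, H ω * L ω ∂P + ∫ ω, L ω ^ 2 ∂P := by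
  have hHL : Integrable (fun ω => 2 * (H ω * L ω)) P := (hH.integrable_mul hL).const_mul 2
  have hdiff : Integrable (fun ω => H ω ^ 2 - 2 * (H ω * L ω)) P := hH.integrable_sq.sub hHL
  simp_rw [sub_sq, mul_assoc (2 : ℝ)]
  rw [integral_add hdiff hL.integrable_sq, integral_sub hH.integrable_sq hHL, integral_const_mul]

variable [IsProbabilityMeasure P]

theorem integral_abs_le_sqrt_integral_sq (hf : MemLp f 2 P) :
    ∫ ω, |f ω| ∂P ≤ √(∫ ω, f ω ^ 2 ∂P) := by
  refine Real.le_sqrt_of_sq_le ?_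
  have hvar := ProbabilityTheory.variance_nonneg |f| P
  rw [ProbabilityTheory.variance_eq_sub hf.abs] at hvar
  simpa using hvar

theorem measureReal_le_add_setIntegral (hH : MemLp H 2 P) (hL : MemLp L 2 P) (hL0 : ∀ ω, 0 ≤ L ω)
    {B : Set Ω} (hB : MeasurableSet B) {η : ℝ} (hη : 0 < η) :
    P.real B ≤ P.real {ω | H ω ≤ η} +
      η⁻¹ * (∫ ω in B, L ω ∂P + √(∫ ω, (H ω - L ω) ^ 2 ∂P)) := by
  have hLint := hL.integrable one_le_two
  have hdist : Integrable (fun ω => |H ω - L ω|) P := ((hH.sub hL).integrable one_le_two).abs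
  have hmarkov : η * P.real (B \ {ω | H ω ≤ η}) ≤
      ∫ ω in B, L ω ∂P + √(∫ ω, (H ω - L ω) ^ 2 ∂P) := by
    calc η * P.real (B \ {ω | H ω ≤ η})
        ≤ η * (P.restrict B).real {ω | η ≤ L ω + |H ω - L ω|} := by
          rw [measureReal_restrict_apply' hB]
          refine mul_le_mul_of_nonneg_left (measureReal_mono fun ω hω => ⟨?_, hω.1⟩) hη.le
          have hlt : η < H ω := not_le.1 hω.2
          have hle := le_abs_self (H ω - L ω)
          rw [Set.mem_ofPred_eq]
          linarith
      _ ≤ ∫ ω in B, (L ω + |H ω - L ω|) ∂P :=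
          mul_meas_ge_le_integral_of_nonneg (.of_forall fun ω => add_nonneg (hL0 ω) (abs_nonneg _))
            (hLint.add hdist).integrableOn η
      _ ≤ ∫ ω in B, L ω ∂P + ∫ ω, |H ω - L ω| ∂P := by
          rw [integral_add hLint.integrableOn hdist.integrableOn]
          exact add_le_add le_rfl
            (setIntegral_le_integral hdist (.of_forall fun _ => abs_nonneg _))
      _ ≤ _ := by
          gcongr
          exact integral_abs_le_sqrt_integral_sq (hH.sub hL)
  calc P.real B ≤ P.real ({ω | H ω ≤ η} ∪ B \ {ω | H ω ≤ η}) :=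
        measureReal_mono (by rw [Set.union_sdiff_self]; exact Set.subset_union_right)
    _ ≤ P.real {ω | H ω ≤ η} + P.real (B \ {ω | H ω ≤ η}) := measureReal_union_le _ _
    _ ≤ _ := by
        gcongr
        rwa [← div_eq_inv_mul, le_div_iff₀' hη]

end LowerBound

section UnorderedContiguity

variable {α β : Type*} [MeasurableSpace α] [MeasurableSpace β] {π : Measure (α × β)}
  [IsProbabilityMeasure π] {k : α × β → ℝ}

theorem IsSquareIntegrableDensity.integral_sampleLaw (hk : IsSquareIntegrableDensity π k) {N : ℕ}
    {G : (Fin N → α) × (Fin N → β) → ℝ} (hG : Measurable G) (hG0 : ∀ z, 0 ≤ G z)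
    (hsymm : ∀ x y (σ : Equiv.Perm (Fin N)), G (x, y ∘ σ) = G (x, y)) :
    ∫ z, G z ∂sampleLaw π N =
      ∫ z, G z * pairingAverage k N z ∂indepSampleLaw π.fst π.snd N :=
  integral_sampleLaw_of_symmetric π.fst π.snd hk.eq_withDensity hk.measurable hk.nonneg hG hG0 hsymm

theorem IsSquareIntegrableDensity.setIntegral_pairingAverage (hk : IsSquareIntegrableDensity π k)
    {N : ℕ} {B : Set ((Fin N → α) × (Fin N → β))} (hB : MeasurableSet B)
    (hsymm : ∀ x y (σ : Equiv.Perm (Fin N)), (x, y ∘ σ) ∈ B ↔ (x, y) ∈ B) :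
    ∫ z in B, pairingAverage k N z ∂indepSampleLaw π.fst π.snd N = (sampleLaw π N).real B := by
  have hindicator := hk.integral_sampleLaw (G := B.indicator 1) (measurable_one.indicator hB)
    (Set.indicator_nonneg fun _ _ => zero_le_one)
    fun x y σ => by classical simp only [Set.indicator_apply, hsymm]; rfl
  rw [← integral_indicator_one hB, hindicator, ← integral_indicator hB]
  refine integral_congr_ae (.of_forall fun z => ?_)
  by_cases hz : z ∈ B <;> simp [hz]

namespace IsCanonicalSystem

variable {K : Type*} [Fintype K] [DecidableEq K] {s : K → ℝ} {φ : K → α → ℝ} {ψ : K → β → ℝ}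

theorem tendstoInDistribution_normalizedSums_indep (h : IsCanonicalSystem π s φ ψ) :
    TendstoInDistribution (normalizedSums φ ψ) atTop id
      (fun N => indepSampleLaw π.fst π.snd N) (gaussianPairs K) := by
  have hlim := h.prod.tendstoInDistribution_normalizedSums fun _ => by norm_num
  simpa only [sampleLaw_prod, correlatedGaussian_zero] using hlim

theorem eventually_measureReal_mehlerProd_le_lt (h : IsCanonicalSystem π s φ ψ)
    (hs : ∀ k, s k ^ 2 < 1) {η a : ℝ} (hη0 : 0 < η) (hη1 : η < 1)
    (ha : (∑ k, s k ^ 2 / (1 - s k ^ 2) + 1) / Real.log η⁻¹ < a) :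
    ∀ᶠ N in atTop, (indepSampleLaw π.fst π.snd N).real
      {z | mehlerProd s (normalizedSums φ ψ N z) ≤ η} < a :=
  eventually_measureReal_preimage_lt h.tendstoInDistribution_normalizedSums_indep
    (isClosed_le (continuous_mehlerProd s) continuous_const)
    ((measureReal_mehlerProd_le hs hη0 hη1).trans_lt ha)

theorem tendsto_integral_min_mehlerProd_sq_sub (h : IsCanonicalSystem π s φ ψ)
    (hk : IsSquareIntegrableDensity π k) (hs : ∀ k, s k ^ 2 < 1) {M : ℝ} (hM : 0 ≤ M) :
    Tendsto (fun N =>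
        ∫ z, min (mehlerProd s (normalizedSums φ ψ N z)) M ^ 2 ∂indepSampleLaw π.fst π.snd N -
        2 * ∫ z, min (mehlerProd s (normalizedSums φ ψ N z)) M * pairingAverage k N z
          ∂indepSampleLaw π.fst π.snd N) atTop
      (𝓝 (∫ x, min (mehlerProd s x) M ^ 2 ∂gaussianPairs K -
        2 * ∫ x, mehlerProd s x * min (mehlerProd s x) M ∂gaussianPairs K)) := by
  have hcont : Continuous fun x => min (mehlerProd s x) M :=
    (continuous_mehlerProd s).min continuous_const
  have hnonneg (x : K → ℝ × ℝ) : 0 ≤ min (mehlerProd s x) M := le_min (mehlerProd_pos hs x).le hM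
  have hbound (x : K → ℝ × ℝ) : |min (mehlerProd s x) M| ≤ M :=
    (abs_of_nonneg (hnonneg x)).trans_le (min_le_right _ _)
  have hindep := tendsto_integral_of_tendstoInDistribution
    h.tendstoInDistribution_normalizedSums_indep
    (g := fun x => min (mehlerProd s x) M ^ 2) (hcont.pow 2) (C := M ^ 2) fun x => by
      rw [abs_pow]
      exact pow_le_pow_left₀ (abs_nonneg _) (hbound x) 2
  have hcoupled := tendsto_integral_of_tendstoInDistribution
    (h.tendstoInDistribution_normalizedSums hs) hcont hbound
  rw [integral_pi_correlatedGaussian hs] at hcoupled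
  refine hindep.sub ((hcoupled.congr fun N => ?_).const_mul 2)
  exact hk.integral_sampleLaw (hcont.measurable.comp (h.measurable_normalizedSums N))
    (fun z => hnonneg _) fun x y σ => by rw [normalizedSums_comp_perm]

theorem eventually_integral_min_mehlerProd_sub_pairingAverage_sq_lt
    (h : IsCanonicalSystem π s φ ψ) (hk : IsSquareIntegrableDensity π k) (hs : ∀ k, s k ^ 2 < 1)
    {C : ℝ} (hL : ∀ N, MemLp (pairingAverage k N) 2 (indepSampleLaw π.fst π.snd N))
    (hC : ∀ N, ∫ z, pairingAverage k N z ^ 2 ∂indepSampleLaw π.fst π.snd N ≤ C) {M δ : ℝ}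
    (hM : 0 ≤ M) (hδ : C - ∫ x, min (mehlerProd s x) M ^ 2 ∂gaussianPairs K < δ) :
    ∀ᶠ N in atTop, ∫ z, (min (mehlerProd s (normalizedSums φ ψ N z)) M - pairingAverage k N z) ^ 2
      ∂indepSampleLaw π.fst π.snd N < δ := by
  have hcont : Continuous fun x => min (mehlerProd s x) M :=
    (continuous_mehlerProd s).min continuous_const
  have hnonneg (x : K → ℝ × ℝ) : 0 ≤ min (mehlerProd s x) M := le_min (mehlerProd_pos hs x).le hM
  have hbound (x : K → ℝ × ℝ) : ‖min (mehlerProd s x) M‖ ≤ M :=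
    (abs_of_nonneg (hnonneg x)).trans_le (min_le_right _ _)
  have hle : ∫ x, min (mehlerProd s x) M ^ 2 ∂gaussianPairs K ≤
      ∫ x, mehlerProd s x * min (mehlerProd s x) M ∂gaussianPairs K := by
    refine integral_mono_of_nonneg (.of_forall fun x => sq_nonneg _)
      ((integrable_mehlerProd hs).mul_bdd (c := M) hcont.aestronglyMeasurable (.of_forall hbound))
      (.of_forall fun x => ?_)
    exact (sq _).trans_le (mul_le_mul_of_nonneg_right (min_le_left _ _) (hnonneg x))
  have hlt : ∫ x, min (mehlerProd s x) M ^ 2 ∂gaussianPairs K -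
      2 * ∫ x, mehlerProd s x * min (mehlerProd s x) M ∂gaussianPairs K < δ - C := by
    linarith
  filter_upwards [(h.tendsto_integral_min_mehlerProd_sq_sub hk hs hM).eventually_lt_const hlt]
    with N hN
  have hmemLp : MemLp (fun z => min (mehlerProd s (normalizedSums φ ψ N z)) M) 2
      (indepSampleLaw π.fst π.snd N) :=
    MemLp.of_bound (hcont.measurable.comp (h.measurable_normalizedSums N)).aestronglyMeasurable M
      (.of_forall fun z => hbound _)
  rw [integral_sub_sq hmemLp (hL N)]
  linarith [hC N]

end IsCanonicalSystem

namespace IsCanonicalExpansion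

variable {ι : Type*} [DecidableEq ι] {s : ι → ℝ} {φ : ι → α → ℝ} {ψ : ι → β → ℝ}

omit [IsProbabilityMeasure π] in
theorem exists_sub_integral_min_mehlerProd_sq_lt (h : IsCanonicalExpansion π k s φ ψ) {δ : ℝ}
    (hδ : 0 < δ) :
    ∃ (F : Finset ι) (M : ℝ), 1 ≤ M ∧ (⨆ F : Finset ι, ∏ i ∈ F, (1 - s i ^ 2)⁻¹) -
      ∫ x, min (mehlerProd (fun i : F => s i) x) M ^ 2 ∂gaussianPairs F < δ := by
  obtain ⟨F, hF⟩ := exists_lt_of_lt_ciSup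
    (sub_lt_self (⨆ F : Finset ι, ∏ i ∈ F, (1 - s i ^ 2)⁻¹) hδ)
  have hs (i : F) : s i ^ 2 < 1 := h.sq_lt_one i
  have hlim := tendsto_integral_min_natCast_sq (memLp_mehlerProd hs)
    fun x => (mehlerProd_pos hs x).le
  rw [integral_mehlerProd_sq hs, Finset.prod_coe_sort F fun i => (1 - s i ^ 2)⁻¹] at hlim
  obtain ⟨n, hlt, hn⟩ := ((hlim.eventually_const_lt hF).and (eventually_ge_atTop 1)).exists
  exact ⟨F, n, Nat.one_le_cast.2 hn, by linarith⟩

theorem eventually_indepSampleLaw_lt [Countable ι] (h : IsCanonicalExpansion π k s φ ψ)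
    (hk : IsSquareIntegrableDensity π k) {D η a c : ℝ}
    (hD : ∀ F : Finset ι, ∑ i ∈ F, s i ^ 2 / (1 - s i ^ 2) ≤ D) (hη0 : 0 < η) (hη1 : η < 1)
    (ha : (D + 1) / Real.log η⁻¹ < a) (hc : 0 < c)
    {B : ∀ N, Set ((Fin N → α) × (Fin N → β))} (hB : ∀ N, MeasurableSet (B N))
    (hsymm : ∀ N x y (σ : Equiv.Perm (Fin N)), (x, y ∘ σ) ∈ B N ↔ (x, y) ∈ B N) :
    ∀ᶠ N in atTop, (indepSampleLaw π.fst π.snd N).real (B N) <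
      a + η⁻¹ * ((sampleLaw π N).real (B N) + c) := by
  obtain ⟨F, M, hM, hFM⟩ := h.exists_sub_integral_min_mehlerProd_sq_lt (pow_pos hc 2)
  have hM0 : 0 ≤ M := zero_le_one.trans hM
  have hF := h.toIsCanonicalSystem.comp_injective (Subtype.val_injective (p := (· ∈ F)))
  have hs (i : F) : s i ^ 2 < 1 := h.sq_lt_one i
  have hL (N : ℕ) := h.memLp_pairingAverage_and_integral_sq_le hk N
  have hlower := hF.eventually_measureReal_mehlerProd_le_lt hs hη0 hη1 (a := a) <|
    ha.trans_le' <| div_le_div_of_nonneg_right (by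
      have := hD F
      rw [← Finset.sum_coe_sort] at this
      exact add_le_add_left this 1) (Real.log_pos ((one_lt_inv₀ hη0).2 hη1)).le
  have hclose := hF.eventually_integral_min_mehlerProd_sub_pairingAverage_sq_lt hk hs
    (fun N => (hL N).1) (fun N => (hL N).2) hM0 hFM
  filter_upwards [hlower, hclose] with N hlowerN hcloseN
  have hmemLp : MemLp (fun z => min (mehlerProd (fun i : F => s i)
      (normalizedSums (fun i : F => φ i) (fun i : F => ψ i) N z)) M) 2
      (indepSampleLaw π.fst π.snd N) :=
    MemLp.of_bound (((continuous_mehlerProd _).min continuous_const).measurable.comp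
      (hF.measurable_normalizedSums N)).aestronglyMeasurable M (.of_forall fun z => by
        rw [Real.norm_eq_abs, abs_of_nonneg (le_min (mehlerProd_pos hs _).le hM0)]
        exact min_le_right _ _)
  have hle := measureReal_le_add_setIntegral hmemLp (hL N).1 (pairingAverage_nonneg hk.nonneg N)
    (hB N) hη0
  rw [hk.setIntegral_pairingAverage (hB N) (hsymm N)] at hle
  simp only [min_le_iff, not_le.2 (hη1.trans_le hM), or_false] at hle
  have hsqrt := (Real.sqrt_lt' hc).2 hcloseN
  calc _ ≤ _ := hle
    _ < _ := add_lt_add_of_lt_of_le hlowerN (by gcongr)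

theorem tendsto_indepSampleLaw_zero [Countable ι] (h : IsCanonicalExpansion π k s φ ψ)
    (hk : IsSquareIntegrableDensity π k)
    {B : ∀ N, Set ((Fin N → α) × (Fin N → β))} (hB : ∀ N, MeasurableSet (B N))
    (hsymm : ∀ N x y (σ : Equiv.Perm (Fin N)), (x, y ∘ σ) ∈ B N ↔ (x, y) ∈ B N)
    (hlim : Tendsto (fun N => (sampleLaw π N).real (B N)) atTop (𝓝 0)) :
    Tendsto (fun N => (indepSampleLaw π.fst π.snd N).real (B N)) atTop (𝓝 0) := by
  obtain ⟨D, hD⟩ := h.exists_sum_sq_div_le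
  refine Metric.tendsto_nhds.2 fun ε hε => ?_
  have hsmall : Tendsto (fun η : ℝ => (D + 1) / Real.log η⁻¹) (𝓝[>] 0) (𝓝 0) :=
    (Real.tendsto_log_atTop.comp tendsto_inv_nhdsGT_zero).const_div_atTop (D + 1)
  obtain ⟨η, hlog, hη0, hη1⟩ := ((hsmall.eventually_lt_const (half_pos hε)).and
    (Ioo_mem_nhdsGT zero_lt_one)).exists
  have hc : 0 < η * (ε / 4) := by positivity
  filter_upwards [h.eventually_indepSampleLaw_lt hk hD hη0 hη1 hlog hc hB hsymm,
    hlim.eventually_lt_const hc] with N hN hQ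
  rw [Real.dist_eq, sub_zero, abs_of_nonneg measureReal_nonneg]
  calc (indepSampleLaw π.fst π.snd N).real (B N)
      < ε / 2 + η⁻¹ * ((sampleLaw π N).real (B N) + η * (ε / 4)) := hN
    _ ≤ ε / 2 + η⁻¹ * (η * (ε / 4) + η * (ε / 4)) := by gcongr
    _ = ε := by
      field_simp
      ring

end IsCanonicalExpansion
end UnorderedContiguity

section EmpiricalContiguity

variable {E : Type*} [MeasurableSpace E]

/-- The first and the second components of the first `N` terms of a sequence of pairs. -/
def splitSample (N : ℕ) (ω : ℕ → E × E) : (Fin N → E) × (Fin N → E) :=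
  (fun i => (ω i).1, fun i => (ω i).2)

/-- The pair of empirical distributions of two samples of the same size. -/
noncomputable def empiricalOfSplit (N : ℕ) (z : (Fin N → E) × (Fin N → E)) :
    Measure E × Measure E :=
  ((N : ℝ≥0∞)⁻¹ • ∑ i, Measure.dirac (z.1 i), (N : ℝ≥0∞)⁻¹ • ∑ i, Measure.dirac (z.2 i))

theorem measurable_splitSample (N : ℕ) : Measurable (splitSample (E := E) N) := by
  unfold splitSample
  fun_prop

theorem measurable_empiricalOfSplit (N : ℕ) : Measurable (empiricalOfSplit (E := E) N) := by
  refine Measurable.prodMk ?_ ?_ <;>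
  · refine Measure.measurable_of_measurable_coe _ fun s hs => ?_
    simp only [Measure.smul_apply, Measure.coe_finsetSum, Finset.sum_apply, smul_eq_mul,
      Measure.dirac_apply' _ hs]
    refine Measurable.const_mul (Finset.measurable_sum _ fun i _ => ?_) _
    exact (measurable_one.indicator hs).comp (by fun_prop)

theorem empiricalPair_eq (N : ℕ) :
    empiricalPair (E := E) N = empiricalOfSplit N ∘ splitSample N := by
  funext ω
  simp only [empiricalPair, empiricalOfSplit, splitSample, Finset.sum_range, Function.comp_apply]

theorem empiricalOfSplit_comp_perm {N : ℕ} (x y : Fin N → E) (σ : Equiv.Perm (Fin N)) :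
    empiricalOfSplit N (x, y ∘ σ) = empiricalOfSplit N (x, y) := by
  simp only [empiricalOfSplit, Function.comp_apply]
  rw [Equiv.sum_comp σ fun i => Measure.dirac (y i)]

variable {π : Measure (E × E)} [IsProbabilityMeasure π]

variable (π) in
theorem map_splitSample (N : ℕ) : (iidLaw π).map (splitSample N) = sampleLaw π N := by
  rw [sampleLaw, iidLaw, ← (measurePreserving_infinitePi_eval_fin π N).map_eq,
    Measure.map_map (MeasurableEquiv.measurable _) (by fun_prop)]
  rfl

variable (π) in
theorem empiricalPairLaw_apply (N : ℕ) {A : Set (Measure E × Measure E)} (hA : MeasurableSet A) :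
    empiricalPairLaw π N A = sampleLaw π N (empiricalOfSplit N ⁻¹' A) := by
  rw [empiricalPairLaw, empiricalPair_eq,
    ← Measure.map_map (measurable_empiricalOfSplit N) (measurable_splitSample N), map_splitSample,
    Measure.map_apply (measurable_empiricalOfSplit N) hA]

theorem isContiguous_empiricalPairLaw [MeasurableSpace.CountablyGenerated E] {k : E × E → ℝ}
    (h : IsSquareIntegrableDensity π k) (hcompact : IsCompactOperator (kernelOperator k h.memLp))
    (hgap : HasEigenvalueGap ((kernelOperator k h.memLp).adjoint ∘L kernelOperator k h.memLp)
      (Lp.const 2 π.fst (1 : ℝ))) :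
    IsContiguous (empiricalPairLaw (π.fst.prod π.snd)) (empiricalPairLaw π) := by
  obtain ⟨ι, _, _, s, φ, ψ, hexp⟩ := h.exists_isCanonicalExpansion hcompact hgap
  intro A hA hlim
  simp only [empiricalPairLaw_apply _ _ (hA _)] at hlim ⊢
  have hreal := hexp.tendsto_indepSampleLaw_zero h
    (fun N => measurable_empiricalOfSplit N (hA N))
    (fun N x y σ => by simp only [Set.mem_preimage, empiricalOfSplit_comp_perm])
    ((ENNReal.tendsto_toReal ENNReal.zero_ne_top).comp hlim)
  simp only [sampleLaw_prod]
  exact (ENNReal.tendsto_toReal_iff (fun N => measure_ne_top _ _) ENNReal.zero_ne_top).1 hreal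

theorem tendsto_iidLaw_zero_of_isContiguous {π₁ π₂ : Measure (E × E)}
    (h : IsContiguous (empiricalPairLaw π₁) (empiricalPairLaw π₂)) {A : ℕ → Set (ℕ → E × E)}
    (hA : ∀ N, MeasurableSet[empiricalSigma E N] (A N))
    (hlim : Tendsto (fun N => iidLaw π₂ (A N)) atTop (𝓝 0)) :
    Tendsto (fun N => iidLaw π₁ (A N)) atTop (𝓝 0) := by
  choose B hB hAB using hA
  have hlaw (π : Measure (E × E)) (N : ℕ) : iidLaw π (A N) = empiricalPairLaw π N (B N) := by
    rw [empiricalPairLaw, Measure.map_apply (measurable_empiricalPair N) (hB N), hAB N]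
  simp only [hlaw] at hlim ⊢
  exact h B hB hlim

theorem measurable_bridgeDensity {c : E → E → ℝ} (hc : Measurable (Function.uncurry c))
    {a b : E → ℝ} (ha : Measurable a) (hb : Measurable b) (ε : ℝ) :
    Measurable (bridgeDensity c ε a b) :=
  (((hc.sub (ha.comp measurable_fst)).sub (hb.comp measurable_snd)).const_mul _).exp

theorem theorem7_general [MeasurableSpace.CountablyGenerated E] {k : E × E → ℝ}
    (h : IsSquareIntegrableDensity π k) (hcompact : IsCompactOperator (kernelOperator k h.memLp))
    (hgap : HasEigenvalueGap ((kernelOperator k h.memLp).adjoint ∘L kernelOperator k h.memLp)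
      (Lp.const 2 π.fst (1 : ℝ))) :
    IsContiguous (empiricalPairLaw (π.fst.prod π.snd)) (empiricalPairLaw π) ∧
    ∀ A : ℕ → Set (ℕ → E × E), (∀ N, MeasurableSet[empiricalSigma E N] (A N)) →
      Tendsto (fun N => iidLaw π (A N)) atTop (𝓝 0) →
      Tendsto (fun N => iidLaw (π.fst.prod π.snd) (A N)) atTop (𝓝 0) :=
  have hcontiguous := isContiguous_empiricalPairLaw h hcompact hgap
  ⟨hcontiguous, fun _ hA => tendsto_iidLaw_zero_of_isContiguous hcontiguous hA⟩

end EmpiricalContiguity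

theorem theorem7 {d : ℕ} (c : EuclideanSpace ℝ (Fin d) → EuclideanSpace ℝ (Fin d) → ℝ)
    (ρ₀ ρ₁ : Measure (EuclideanSpace ℝ (Fin d)))
    [IsProbabilityMeasure ρ₀] [IsProbabilityMeasure ρ₁]
    (hρ₀ : ρ₀ ≪ volume) (hρ₁ : ρ₁ ≪ volume)
    -- the cost function and its growth
    (hc_cont : Continuous (Function.uncurry c))
    (hc_nonneg : ∀ x y, 0 ≤ c x y)
    (hc_zero : ∀ x y, c x y = 0 ↔ x = y)
    (p : ℝ) (hp : 1 ≤ p)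
    (hc_growth : ∃ A B M : ℝ, 0 < A ∧ 0 < B ∧
      ∀ x y, M ≤ ‖x‖ → M ≤ ‖y‖ → c x y ≤ A + B * (‖x‖ ^ p + ‖y‖ ^ p))
    -- moments of the marginals
    (hmom₀ : Integrable (fun x => ‖x‖ ^ p) ρ₀) (hmom₁ : Integrable (fun y => ‖y‖ ^ p) ρ₁)
    -- the Schrödinger bridge and its potentials
    (ε : ℝ) (hε : 0 < ε) (a b : EuclideanSpace ℝ (Fin d) → ℝ)
    (μ : Measure (EuclideanSpace ℝ (Fin d) × EuclideanSpace ℝ (Fin d))) [IsProbabilityMeasure μ]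
    (hμ : IsSchrodingerBridge c ε ρ₀ ρ₁ a b μ)
    (ha : Integrable a ρ₀) (hb : Integrable b ρ₁)
    -- square integrability, compactness and spectral gap
    (hξ : MemLp (bridgeDensity c ε a b) 2 (ρ₀.prod ρ₁))
    (hcompact : IsCompactOperator (kernelOperator (bridgeDensity c ε a b) hξ))
    (hgap₀ : HasEigenvalueGap
      ((kernelOperator (bridgeDensity c ε a b) hξ).adjoint ∘L
        kernelOperator (bridgeDensity c ε a b) hξ) (Lp.const 2 ρ₀ (1 : ℝ)))
    (hgap₁ : HasEigenvalueGap
      (kernelOperator (bridgeDensity c ε a b) hξ ∘L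
        (kernelOperator (bridgeDensity c ε a b) hξ).adjoint) (Lp.const 2 ρ₁ (1 : ℝ))) :
    IsContiguous (empiricalPairLaw (ρ₀.prod ρ₁)) (empiricalPairLaw μ) ∧
    ∀ A : ℕ → Set (ℕ → EuclideanSpace ℝ (Fin d) × EuclideanSpace ℝ (Fin d)),
      (∀ N, MeasurableSet[empiricalSigma (EuclideanSpace ℝ (Fin d)) N] (A N)) →
      Tendsto (fun N => iidLaw μ (A N)) atTop (𝓝 0) →
      Tendsto (fun N => iidLaw (ρ₀.prod ρ₁) (A N)) atTop (𝓝 0) := by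
  obtain rfl := hμ.fst_eq
  obtain rfl := hμ.snd_eq
  exact theorem7_general
    ⟨measurable_bridgeDensity hc_cont.measurable hμ.measurable_left hμ.measurable_right ε,
      fun z => (Real.exp_pos _).le, hξ, hμ.eq_withDensity⟩ hcompact hgap₀
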